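/- **Theorem (unique solvability of the weak Galerkin scheme for the elliptic interface problem).** *Geometry.* Let $\Omega\subset\mathbb R^2$ be a bounded polygonal domain, and let $\mathcal T_h$ be a finite partition of $\Omega$ into (open, convex or nonconvex) polygonal elements $T$, with set of edges $\mathcal E_h$; distinct edges meet at most in common endpoints (so a hanging node splits a side into several edges), and $\Omega$ and every $T$ lie locally on one side of each of their boundary edges. Let $\Omega_1,\Omega_2\subset\Omega$ be disjoint open sets with $\overline\Omega=\overline{\Omega_1}\cup\overline{\Omega_2}$ such that every element lies in $\Omega_1$ or in $\Omega_2$, and let $\Gamma=\overline{\Omega_1}\cap\overline{\Omega_2}$ be the interface. Assume that every nonempty set $S$ of interior edges contains an edge $e$ belonging to some element $T$ no other edge of which lies both in $S$ and on the straight line through $e$. (This holds, for instance, if no element has two edges on one straight line.) *Data.* Let $f\in L^2(\Omega)$, let $g$ be square integrable on $\partial\Omega\setminus\Gamma$ and let $g_D,g_N$ be square integrable on $\Gamma$. Let $a$ be a bounded measurable field of symmetric $2\times2$ matrices that is uniformly positive definite on $\Omega$ (for example a constant matrix on each of $\Omega_1$, $\Omega_2$). *Discrete spaces.* Let $k\ge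 q\ge0$ be integers. For each element $T$ with $N_T$ edges let $r_T$ be an integer with $r_T\ge N_T+k-1$ if $T$ is convex and $r_T\ge 2N_T+k-1$ if $T$ is nonconvex. Let $V_h$ be the space of all families $v=\{v_0,v_b\}$ consisting of a polynomial $v_0|_T\in P_k(T)$ for each $T$ and a polynomial $v_b|_e\in P_q(e)$ for each edge $e\subset\partial T$ of each $T$, where $v_b$ is single-valued on every interior edge not contained in $\Gamma$, while on an edge $e\subset\Gamma$ the values from the two sides may differ; for $e\subset\Gamma$ shared by $T_1\subset\Omega_1$ and $T_2\subset\Omega_2$ put $[[v_b]]_e=v_b|_{\partial T_1\cap e}-v_b|_{\partial T_2\cap e}$. Let $$V_h^0=\{v\in V_h:\ v_b=0\text{ on }\partial\Omega,\ [[v_b]]_\Gamma=0\}.$$ For $v\in V_h$ the discrete weak gradient $\nabla_w v|_T\in[P_{r_T}(T)]^2$ is the unique polynomial vector with $$(\nabla_w v,\varphi)_T=-(v_0,\nabla\cdot\varphi)_T+\langle v_b,\varphi\cdot\mathbf n\rangle_{\partial T}\qquad\forall\varphi\in[P_{r_T}(T)]^2,$$ where $\mathbf n$ is the outward unit normal vector.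 On each edge $e$ let $Q_b$ be the $L^2$ projection onto $P_q(e)$. *Conclusion.* There is exactly one $u_h=\{u_0,u_b\}\in V_h$ with $u_b=Q_bg$ on $\partial\Omega\setminus\Gamma$ and $[[u_b]]_\Gamma=Q_bg_D$ such that $$\sum_{T\in\mathcal T_h}(a\nabla_wu_h,\nabla_wv)_T=(f,v_0)+\sum_{e\subset\Gamma}\langle g_N,v_b\rangle_e\qquad\forall v=\{v_0,v_b\}\in V_h^0 .$$ -/

import Mathlib

open MeasureTheory Set Filter Topology

noncomputable section

namespace WG

/-- The Euclidean plane. -/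
abbrev Pt := EuclideanSpace ℝ (Fin 2)

/-! ## Edges and polygonal regions -/

/-- A nondegenerate line segment; the order of its endpoints only fixes a parametrization. -/
structure Edge where
  a : Pt
  b : Pt
  ne : a ≠ b

namespace Edge

def carrier (e : Edge) : Set Pt := segment ℝ e.a e.b

def relInterior (e : Edge) : Set Pt := openSegment ℝ e.a e.b

/-- The straight line through the edge. -/
def line (e : Edge) : Set Pt := (affineSpan ℝ {e.a, e.b} : Set Pt)

def length (e : Edge) : ℝ := dist e.a e.b

/-- The affine parametrization `t ↦ a + t (b - a)`, with `t ∈ [0, 1]` on the edge. -/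
def point (e : Edge) (t : ℝ) : Pt := e.a + t • (e.b - e.a)

/-- A unit vector perpendicular to the edge. -/
def normal (e : Edge) : Pt :=
  e.length⁻¹ • !₂[-((e.b - e.a) 1), (e.b - e.a) 0]

/-- Integral with respect to arc length along the edge, the integrand being given as a function
of the affine parameter. -/
def integral (e : Edge) (φ : ℝ → ℝ) : ℝ := e.length * ∫ t in (0 : ℝ)..1, φ t

/-- Square integrability along the edge of a function on the plane. -/
def SquareIntegrable (e : Edge) (g : Pt → ℝ) : Prop :=
  MemLp (fun t => g (e.point t)) 2 (volume.restrict (Icc (0 : ℝ) 1))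

/-- Near each relatively interior point of `e`, the points on the side of `e` to which `ν` points
belong to `S`, and those on the opposite side do not. -/
def SideIs (e : Edge) (ν : Pt) (S : Set Pt) : Prop :=
  ∀ x ∈ e.relInterior, ∀ᶠ t : ℝ in 𝓝[>] 0, x + t • ν ∈ S ∧ x - t • ν ∉ S

open Classical in
/-- The unit normal vector to `e` that points out of `S`, for a region `S` lying (locally) on one
side of `e`. -/
def outwardNormal (e : Edge) (S : Set Pt) : Pt :=
  if e.SideIs e.normal S then -e.normal else e.normal

end Edge

/-- A (convex or nonconvex) open polygon whose sides are given by edges of the family `edge`: a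
bounded domain whose boundary is the union of those edges that it contains, and which lies
locally on one side of each of these. -/
structure IsPolygon {κ : Type*} (edge : κ → Edge) (S : Set Pt) : Prop where
  isOpen : IsOpen S
  isConnected : IsConnected S
  isBounded : Bornology.IsBounded S
  frontier_eq : frontier S = ⋃ j ∈ {j | (edge j).carrier ⊆ frontier S}, (edge j).carrier
  one_sided : ∀ j, (edge j).carrier ⊆ frontier S →
    (edge j).SideIs (edge j).normal S ∨ (edge j).SideIs (-(edge j).normal) S

/-- A partition of the polygonal domain `Ω` into polygonal elements `cell i`, `i : ι` (open sets),
with the family of all edges `edge j`, `j : κ`. Distinct edges meet at most in common endpoints,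
so a vertex of one element in the boundary of a neighbour ("hanging node") splits the
corresponding side of the neighbour into several edges. -/
structure PolygonalMesh (Ω : Set Pt) (ι κ : Type*) where
  cell : ι → Set Pt
  edge : κ → Edge
  domain : IsPolygon edge Ω
  polygon : ∀ i, IsPolygon edge (cell i)
  edge_inter : ∀ j j', j ≠ j' → (edge j).carrier ∩ (edge j').carrier ⊆
    {(edge j).a, (edge j).b} ∩ {(edge j').a, (edge j').b}
  cell_subset : ∀ i, cell i ⊆ Ω
  cell_disjoint : ∀ i i', i ≠ i' → Disjoint (cell i) (cell i')
  cover : closure Ω = ⋃ i, closure (cell i)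
  edge_used : ∀ j, ∃ i, (edge j).carrier ⊆ frontier (cell i)

/-- The interface between two subdomains. -/
def interface (Ω₁ Ω₂ : Set Pt) : Set Pt := closure Ω₁ ∩ closure Ω₂

/-- The domain is decomposed into two disjoint open subdomains, and each element lies in one of
the two. -/
structure IsInterfaceFitted {Ω : Set Pt} {ι κ : Type*} (M : PolygonalMesh Ω ι κ)
    (Ω₁ Ω₂ : Set Pt) : Prop where
  isOpen₁ : IsOpen Ω₁
  isOpen₂ : IsOpen Ω₂
  subset₁ : Ω₁ ⊆ Ω
  subset₂ : Ω₂ ⊆ Ω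
  disjoint : Disjoint Ω₁ Ω₂
  closure_eq : closure Ω = closure Ω₁ ∪ closure Ω₂
  fitted : ∀ i, M.cell i ⊆ Ω₁ ∨ M.cell i ⊆ Ω₂

/-- A bounded measurable field of symmetric matrices, uniformly positive definite on `Ω`. -/
structure IsDiffusionTensor (Ω : Set Pt) (A : Pt → Matrix (Fin 2) (Fin 2) ℝ) : Prop where
  aestronglyMeasurable : ∀ l m, AEStronglyMeasurable (fun x => A x l m) (volume.restrict Ω)
  bounded : ∃ C : ℝ, ∀ x ∈ Ω, ∀ l m, |A x l m| ≤ C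
  isSymm : ∀ x ∈ Ω, (A x).IsSymm
  posDef : ∃ c : ℝ, 0 < c ∧ ∀ x ∈ Ω, ∀ ξ : Fin 2 → ℝ, c * (ξ ⬝ᵥ ξ) ≤ ξ ⬝ᵥ (A x).mulVec ξ

/-! ## Polynomial spaces -/

/-- `P_k`: polynomials in two variables of total degree at most `k`. -/
abbrev Poly (k : ℕ) : Submodule ℝ (MvPolynomial (Fin 2) ℝ) :=
  MvPolynomial.restrictTotalDegree (Fin 2) ℝ k

/-- The value at a point of the plane of a polynomial in two variables. -/
def peval (x : Pt) (p : MvPolynomial (Fin 2) ℝ) : ℝ := MvPolynomial.eval (fun l => x l) p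

/-- `[P_r]²`. -/
abbrev VecPoly (r : ℕ) := Fin 2 → Poly r

/-- The value at a point of the plane of a polynomial vector field. -/
def VecPoly.val {r : ℕ} (φ : VecPoly r) (x : Pt) : Fin 2 → ℝ := fun l => peval x (φ l)

/-- The divergence of a polynomial vector field. -/
def VecPoly.div {r : ℕ} (φ : VecPoly r) : MvPolynomial (Fin 2) ℝ :=
  ∑ l, MvPolynomial.pderiv l (φ l : MvPolynomial (Fin 2) ℝ)

/-- `P_q(e)`: polynomials on an edge of degree at most `q`, written in the affine parameter. -/
abbrev EdgePoly (q : ℕ) : Submodule ℝ (Polynomial ℝ) := Polynomial.degreeLE ℝ (q : WithBot ℕ)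

instance (q : ℕ) : FiniteDimensional ℝ (EdgePoly q) := by
  classical
  unfold EdgePoly
  rw [Polynomial.degreeLE_eq_span_X_pow]
  exact FiniteDimensional.span_finset ℝ _

/-! ## The discrete weak gradient and the projection on edges are well defined -/

/-- Riesz representation in finite dimension. -/
theorem existsUnique_repr {V : Type*} [AddCommGroup V] [Module ℝ V] [FiniteDimensional ℝ V]
    (B : V →ₗ[ℝ] V →ₗ[ℝ] ℝ) (hB : ∀ v, B v v = 0 → v = 0) (L : V →ₗ[ℝ] ℝ) :
    ∃! v, ∀ w, B v w = L w := by
  have hinj : Function.Injective B := by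
    rw [← LinearMap.ker_eq_bot, LinearMap.ker_eq_bot']
    intro v hv
    exact hB v (by rw [hv]; rfl)
  have hsurj : Function.Surjective B :=
    (LinearMap.injective_iff_surjective_of_finrank_eq_finrank
      (Subspace.dual_finrank_eq (K := ℝ) (V := V)).symm).1 hinj
  obtain ⟨v, hv⟩ := hsurj L
  refine ⟨v, fun w => by rw [hv], fun v' hv' => hinj ?_⟩
  rw [hv]
  exact LinearMap.ext hv'

theorem continuous_peval (p : MvPolynomial (Fin 2) ℝ) : Continuous fun x : Pt => peval x p := by
  unfold peval
  exact (MvPolynomial.continuous_eval p).comp (by fun_prop)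

theorem Edge.continuous_point (e : Edge) : Continuous e.point := by
  unfold Edge.point
  fun_prop

theorem integrableOn_of_continuous {S : Set Pt} (hS : Bornology.IsBounded S) {φ : Pt → ℝ}
    (hφ : Continuous φ) : IntegrableOn φ S :=
  (hφ.continuousOn.integrableOn_compact hS.isCompact_closure).mono_set subset_closure

theorem eq_zero_of_peval_eq_zero {S : Set Pt} (hS : IsOpen S) (hne : S.Nonempty)
    {p : MvPolynomial (Fin 2) ℝ} (hp : ∀ x ∈ S, peval x p = 0) : p = 0 := by
  obtain ⟨x₀, hx₀⟩ := hne
  have hopen : IsOpen ((fun y : Fin 2 → ℝ => (WithLp.toLp 2 y : Pt)) ⁻¹' S) :=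
    hS.preimage (PiLp.continuous_toLp 2 _)
  obtain ⟨ε, hε, hball⟩ := Metric.isOpen_iff.1 hopen (fun l => x₀ l) hx₀
  rw [ball_pi _ hε] at hball
  refine MvPolynomial.funext_set (fun l => Metric.ball (x₀ l) ε) (fun l => ?_) fun y hy => ?_
  · rw [Real.ball_eq_Ioo]
    exact Ioo_infinite (by linarith)
  · rw [map_zero]
    exact hp (WithLp.toLp 2 y) (hball hy)

/-- The pairing `(φ, ψ)_S` on polynomial vector fields, as a bilinear map. -/
def vecForm (r : ℕ) {S : Set Pt} (hS : Bornology.IsBounded S) :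
    VecPoly r →ₗ[ℝ] VecPoly r →ₗ[ℝ] ℝ :=
  LinearMap.mk₂ ℝ (fun φ ψ => ∫ x in S, φ.val x ⬝ᵥ ψ.val x)
    (fun φ φ' ψ => by
      rw [← integral_add]
      · congr 1; ext x
        simp [VecPoly.val, dotProduct, peval, Fin.sum_univ_two]; ring
      all_goals
        refine integrableOn_of_continuous hS ?_
        simp only [VecPoly.val, dotProduct]
        exact continuous_finsetSum _ fun l _ => (continuous_peval _).mul (continuous_peval _))
    (fun c φ ψ => by
      rw [smul_eq_mul, ← integral_const_mul]
      congr 1; ext x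
      simp [VecPoly.val, dotProduct, peval, Fin.sum_univ_two]; ring)
    (fun φ ψ ψ' => by
      rw [← integral_add]
      · congr 1; ext x
        simp [VecPoly.val, dotProduct, peval, Fin.sum_univ_two]; ring
      all_goals
        refine integrableOn_of_continuous hS ?_
        simp only [VecPoly.val, dotProduct]
        exact continuous_finsetSum _ fun l _ => (continuous_peval _).mul (continuous_peval _))
    (fun c φ ψ => by
      rw [smul_eq_mul, ← integral_const_mul]
      congr 1; ext x
      simp [VecPoly.val, dotProduct, peval, Fin.sum_univ_two]; ring)

theorem vecForm_definite (r : ℕ) {S : Set Pt} (hS : Bornology.IsBounded S) (ho : IsOpen S)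
    (hne : S.Nonempty) (φ : VecPoly r) (h : vecForm r hS φ φ = 0) : φ = 0 := by
  have hc : Continuous fun x => φ.val x ⬝ᵥ φ.val x := by
    simp only [VecPoly.val, dotProduct]
    exact continuous_finsetSum _ fun l _ => (continuous_peval _).mul (continuous_peval _)
  have h0 : ∫ x in S, φ.val x ⬝ᵥ φ.val x = 0 := h
  have hn : ∀ x, 0 ≤ φ.val x ⬝ᵥ φ.val x := fun x =>
    Finset.sum_nonneg fun l _ => mul_self_nonneg _
  rw [setIntegral_eq_zero_iff_of_nonneg_ae (Eventually.of_forall hn)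
    (integrableOn_of_continuous hS hc)] at h0
  have h1 := Measure.eqOn_open_of_ae_eq h0 ho hc.continuousOn continuousOn_const
  funext l
  apply Subtype.ext
  refine eq_zero_of_peval_eq_zero ho hne fun x hx => ?_
  have h2 : φ.val x = 0 := dotProduct_self_eq_zero.1 (h1 hx)
  exact congrFun h2 l

/-- The `L²` pairing on the polynomials on an edge, as a bilinear map. -/
def edgeForm (q : ℕ) (e : Edge) : EdgePoly q →ₗ[ℝ] EdgePoly q →ₗ[ℝ] ℝ :=
  LinearMap.mk₂ ℝ (fun p w => e.integral fun t => p.1.eval t * w.1.eval t)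
    (fun p p' w => by
      unfold Edge.integral
      rw [← mul_add, ← intervalIntegral.integral_add]
      · simp [add_mul]
      all_goals exact (p_cont _ _).intervalIntegrable _ _)
    (fun c p w => by
      unfold Edge.integral
      simp [mul_assoc, mul_left_comm])
    (fun p w w' => by
      unfold Edge.integral
      rw [← mul_add, ← intervalIntegral.integral_add]
      · simp [mul_add]
      all_goals exact (p_cont _ _).intervalIntegrable _ _)
    (fun c p w => by
      unfold Edge.integral
      simp [mul_left_comm])
where
  p_cont (p w : Polynomial ℝ) : Continuous fun t : ℝ => p.eval t * w.eval t :=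
    p.continuous.mul w.continuous

theorem Edge.length_pos (e : Edge) : 0 < e.length := dist_pos.2 e.ne

theorem edgeForm_definite (q : ℕ) (e : Edge) (p : EdgePoly q) (h : edgeForm q e p p = 0) :
    p = 0 := by
  have h0 : e.length * ∫ t in (0 : ℝ)..1, p.1.eval t * p.1.eval t = 0 := h
  replace h0 := (mul_eq_zero.1 h0).resolve_left e.length_pos.ne'
  have hc : Continuous fun t : ℝ => p.1.eval t * p.1.eval t := p.1.continuous.mul p.1.continuous
  rw [intervalIntegral.integral_of_le zero_le_one, ← integral_Icc_eq_integral_Ioc,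
    integral_Icc_eq_integral_Ioo, setIntegral_eq_zero_iff_of_nonneg_ae
    (Eventually.of_forall fun x => mul_self_nonneg _)
    ((hc.integrableOn_Icc (a := 0) (b := 1)).mono_set Ioo_subset_Icc_self)] at h0
  have h1 := Measure.eqOn_open_of_ae_eq h0 isOpen_Ioo hc.continuousOn continuousOn_const
  apply Subtype.ext
  refine Polynomial.eq_zero_of_infinite_isRoot _
    ((Ioo_infinite (zero_lt_one (α := ℝ))).mono fun t ht => ?_)
  exact mul_self_eq_zero.1 (h1 ht)

theorem edgeProj_existsUnique (q : ℕ) (e : Edge) {g : Pt → ℝ} (hg : e.SquareIntegrable g) :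
    ∃! p : EdgePoly q, ∀ w : EdgePoly q,
      (e.integral fun t => p.1.eval t * w.1.eval t) =
        e.integral fun t => g (e.point t) * w.1.eval t := by
  have hi : ∀ w : Polynomial ℝ,
      IntervalIntegrable (fun t => g (e.point t) * w.eval t) volume 0 1 := fun w => by
    rw [intervalIntegrable_iff_integrableOn_Icc_of_le zero_le_one]
    have h1 : IntegrableOn (fun t => g (e.point t)) (Icc (0 : ℝ) 1) :=
      MemLp.integrable (by norm_num) hg
    exact h1.mul_continuousOn w.continuous.continuousOn isCompact_Icc
  let L : EdgePoly q →ₗ[ℝ] ℝ :=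
    { toFun := fun w => e.integral fun t => g (e.point t) * w.1.eval t
      map_add' := fun w w' => by
        unfold Edge.integral
        rw [← mul_add, ← intervalIntegral.integral_add (hi _) (hi _)]
        simp [mul_add]
      map_smul' := fun c w => by
        unfold Edge.integral
        simp [mul_left_comm] }
  exact existsUnique_repr (edgeForm q e) (edgeForm_definite q e) L

open Classical in
/-- `Q_b`: the `L²` projection onto `P_q(e)` of a function that is square integrable on `e`
(zero for other functions). -/
def edgeProj (q : ℕ) (e : Edge) (g : Pt → ℝ) : EdgePoly q :=
  if hg : e.SquareIntegrable g then (edgeProj_existsUnique q e hg).choose else 0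

theorem edgeProj_spec (q : ℕ) (e : Edge) {g : Pt → ℝ} (hg : e.SquareIntegrable g)
    (w : EdgePoly q) :
    (e.integral fun t => (edgeProj q e g).1.eval t * w.1.eval t) =
      e.integral fun t => g (e.point t) * w.1.eval t := by
  unfold edgeProj
  rw [dif_pos hg]
  exact (edgeProj_existsUnique q e hg).choose_spec.1 w

/-! ## Weak finite element spaces -/

variable {Ω : Set Pt} {ι κ : Type*}

namespace PolygonalMesh

/-- The edges of the element `i`. -/
abbrev EdgeOf (M : PolygonalMesh Ω ι κ) (i : ι) : Type _ :=
  {j : κ // (M.edge j).carrier ⊆ frontier (M.cell i)}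

open Classical in
/-- The degree used for the discrete weak gradient on an element with `N` edges:
`N + k - 1` if the element is convex and `2 N + k - 1` if it is not. -/
def gradDegree (M : PolygonalMesh Ω ι κ) (k : ℕ) (i : ι) : ℕ :=
  if Convex ℝ (M.cell i) then Nat.card (M.EdgeOf i) + k - 1
  else 2 * Nat.card (M.EdgeOf i) + k - 1

/-- `V(k, q, T)` for the element `T = cell i`: pairs `{v₀, v_b}` of a polynomial of degree at most
`k` on `T` and, on each edge of `T`, a polynomial of degree at most `q`. -/
abbrev LocalSpace (M : PolygonalMesh Ω ι κ) (k q : ℕ) (i : ι) : Type _ :=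
  Poly k × (M.EdgeOf i → EdgePoly q)

/-- Families of local weak functions, without any matching between the elements. -/
abbrev BrokenSpace (M : PolygonalMesh Ω ι κ) (k q : ℕ) : Type _ :=
  ∀ i, M.LocalSpace k q i

variable [Fintype κ] (M : PolygonalMesh Ω ι κ) {k q : ℕ}

open Classical in
/-- The right-hand side `-(v₀, ∇·φ)_T + ⟨v_b, φ·n⟩_{∂T}` in the definition of the discrete weak
gradient. -/
def weakGradRhs {r : ℕ} (i : ι) (v : M.LocalSpace k q i) (φ : VecPoly r) : ℝ :=
  -(∫ x in M.cell i, peval x v.1 * peval x φ.div) +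
    ∑ j : M.EdgeOf i, (M.edge j).integral fun t =>
      (v.2 j).1.eval t *
        (φ.val ((M.edge j).point t) ⬝ᵥ fun l => (M.edge j).outwardNormal (M.cell i) l)

theorem weakGrad_existsUnique (r : ℕ) (i : ι) (v : M.LocalSpace k q i) :
    ∃! G : VecPoly r, ∀ φ : VecPoly r,
      ∫ x in M.cell i, G.val x ⬝ᵥ φ.val x = M.weakGradRhs i v φ := by
  have hb := (M.polygon i).isBounded
  let L : VecPoly r →ₗ[ℝ] ℝ :=
    { toFun := fun φ => M.weakGradRhs i v φ
      map_add' := fun φ ψ => by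
        unfold weakGradRhs
        have h1 : ∫ x in M.cell i, peval x v.1 * peval x (φ + ψ).div =
            (∫ x in M.cell i, peval x v.1 * peval x φ.div) +
              ∫ x in M.cell i, peval x v.1 * peval x ψ.div := by
          rw [← integral_add]
          · congr 1; ext x
            simp [VecPoly.div, peval, Fin.sum_univ_two]; ring
          all_goals
            exact integrableOn_of_continuous hb ((continuous_peval _).mul (continuous_peval _))
        have h2 : ∀ j : M.EdgeOf i, ((M.edge j).integral fun t => (v.2 j).1.eval t *
            ((φ + ψ).val ((M.edge j).point t) ⬝ᵥ
              fun l => (M.edge j).outwardNormal (M.cell i) l)) =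
            ((M.edge j).integral fun t => (v.2 j).1.eval t * (φ.val ((M.edge j).point t) ⬝ᵥ
              fun l => (M.edge j).outwardNormal (M.cell i) l)) +
            (M.edge j).integral fun t => (v.2 j).1.eval t * (ψ.val ((M.edge j).point t) ⬝ᵥ
              fun l => (M.edge j).outwardNormal (M.cell i) l) := fun j => by
          unfold Edge.integral
          rw [← mul_add, ← intervalIntegral.integral_add]
          · congr 2; ext t
            simp [VecPoly.val, dotProduct, peval, Fin.sum_univ_two]; ring
          all_goals
            refine Continuous.intervalIntegrable ((v.2 j).1.continuous.mul ?_) _ _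
            simp only [VecPoly.val, dotProduct]
            exact continuous_finsetSum _ fun l _ =>
              ((continuous_peval _).comp (M.edge j).continuous_point).mul continuous_const
        rw [h1, Finset.sum_congr rfl fun j _ => h2 j, Finset.sum_add_distrib]
        ring
      map_smul' := fun c φ => by
        unfold weakGradRhs
        have h1 : ∫ x in M.cell i, peval x v.1 * peval x (c • φ).div =
            c * ∫ x in M.cell i, peval x v.1 * peval x φ.div := by
          rw [← integral_const_mul]
          congr 1; ext x
          simp [VecPoly.div, peval, Fin.sum_univ_two]; ring
        have h2 : ∀ j : M.EdgeOf i, ((M.edge j).integral fun t => (v.2 j).1.eval t *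
            ((c • φ).val ((M.edge j).point t) ⬝ᵥ
              fun l => (M.edge j).outwardNormal (M.cell i) l)) =
            c * (M.edge j).integral fun t => (v.2 j).1.eval t * (φ.val ((M.edge j).point t) ⬝ᵥ
              fun l => (M.edge j).outwardNormal (M.cell i) l) := fun j => by
          unfold Edge.integral
          rw [mul_left_comm, ← intervalIntegral.integral_const_mul c]
          refine congrArg ((M.edge j).length * ·) (congrArg (fun F : ℝ → ℝ => ∫ t in (0 : ℝ)..1, F t)
            (funext fun t => ?_))
          simp [VecPoly.val, dotProduct, peval, Fin.sum_univ_two]; ring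
        rw [h1, Finset.sum_congr rfl fun j _ => h2 j, ← Finset.mul_sum]
        simp only [RingHom.id_apply, smul_eq_mul]
        ring }
  exact existsUnique_repr (vecForm r hb)
    (vecForm_definite r hb (M.polygon i).isOpen (M.polygon i).isConnected.nonempty) L

/-- The discrete weak gradient `∇_{w,r,T} v`, for the element `T = cell i`. -/
def weakGrad (r : ℕ) (i : ι) (v : M.LocalSpace k q i) : VecPoly r :=
  (M.weakGrad_existsUnique r i v).choose

theorem weakGrad_spec (r : ℕ) (i : ι) (v : M.LocalSpace k q i) (φ : VecPoly r) :
    ∫ x in M.cell i, (M.weakGrad r i v).val x ⬝ᵥ φ.val x = M.weakGradRhs i v φ :=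
  (M.weakGrad_existsUnique r i v).choose_spec.1 φ

/-- `V_h`: the boundary component is single-valued on every interior edge that does not lie on the
interface `Γ`; on an edge in `Γ` it may take different values from the two sides. -/
def space (M : PolygonalMesh Ω ι κ) (k q : ℕ) (Γ : Set Pt) : Submodule ℝ (M.BrokenSpace k q) where
  carrier := {v | ∀ (i i' : ι) (j : κ) (h : (M.edge j).carrier ⊆ frontier (M.cell i))
    (h' : (M.edge j).carrier ⊆ frontier (M.cell i')), ¬ (M.edge j).carrier ⊆ Γ →
      (v i).2 ⟨j, h⟩ = (v i').2 ⟨j, h'⟩}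
  add_mem' := fun hv hw i i' j h h' hj => by
    simp [hv i i' j h h' hj, hw i i' j h h' hj]
  zero_mem' := fun _ _ _ _ _ _ => rfl
  smul_mem' := fun c v hv i i' j h h' hj => by
    simp [hv i i' j h h' hj]

/-- `V_h⁰`: the boundary component is single-valued on all edges (no jump on the interface) and
vanishes on `∂Ω`. -/
def testSpace (M : PolygonalMesh Ω ι κ) (k q : ℕ) : Submodule ℝ (M.BrokenSpace k q) where
  carrier := {v |
    (∀ (i i' : ι) (j : κ) (h : (M.edge j).carrier ⊆ frontier (M.cell i))
      (h' : (M.edge j).carrier ⊆ frontier (M.cell i')), (v i).2 ⟨j, h⟩ = (v i').2 ⟨j, h'⟩) ∧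
    ∀ (i : ι) (j : M.EdgeOf i), (M.edge j).carrier ⊆ frontier Ω → (v i).2 j = 0}
  add_mem' := fun hv hw => ⟨fun i i' j h h' => by
    simp [hv.1 i i' j h h', hw.1 i i' j h h'], fun i j hj => by
    simp [hv.2 i j hj, hw.2 i j hj]⟩
  zero_mem' := ⟨fun _ _ _ _ _ => rfl, fun _ _ _ => rfl⟩
  smul_mem' := fun c v hv => ⟨fun i i' j h h' => by
    simp [hv.1 i i' j h h'], fun i j hj => by
    simp [hv.2 i j hj]⟩

/-- `∑_T (A ∇_w v, ∇_w w)_T`, where the weak gradient on the element `i` has degree `r i`. -/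
def energyForm [Fintype ι] (A : Pt → Matrix (Fin 2) (Fin 2) ℝ) (r : ι → ℕ)
    (v w : M.BrokenSpace k q) : ℝ :=
  ∑ i, ∫ x in M.cell i,
    (A x).mulVec ((M.weakGrad (r i) i (v i)).val x) ⬝ᵥ (M.weakGrad (r i) i (w i)).val x

open Classical in
/-- `(f, v₀) + ∑_{e ⊂ Γ} ⟨g_N, v_b⟩_e`. The value of `v_b` on an edge in `Γ` is read off in the
element on the side of `Ω₁`; for `v` in the test space both sides give the same value. -/
def load [Fintype ι] (Ω₁ Ω₂ : Set Pt) (f gN : Pt → ℝ) (v : M.BrokenSpace k q) : ℝ :=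
  ∑ i, (∫ x in M.cell i, f x * peval x (v i).1) +
    ∑ i, ∑ j : M.EdgeOf i,
      if M.cell i ⊆ Ω₁ ∧ (M.edge j).carrier ⊆ interface Ω₁ Ω₂ then
        (M.edge j).integral fun t => gN ((M.edge j).point t) * ((v i).2 j).1.eval t
      else 0

/-- `u` solves the weak Galerkin scheme: `u ∈ V_h`, `u_b = Q_b g` on `∂Ω ∖ Γ`,
`u_b|_{∂T₁} - u_b|_{∂T₂} = Q_b g_D` on each edge in `Γ` shared by elements `T₁ ⊆ Ω₁` and
`T₂ ⊆ Ω₂`, and the discrete equation holds for all test functions in `V_h⁰`. -/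
structure IsWGSolution [Fintype ι] (Ω₁ Ω₂ : Set Pt) (A : Pt → Matrix (Fin 2) (Fin 2) ℝ)
    (f g gD gN : Pt → ℝ) (r : ι → ℕ) (u : M.BrokenSpace k q) : Prop where
  mem_space : u ∈ M.space k q (interface Ω₁ Ω₂)
  boundary : ∀ (i : ι) (j : M.EdgeOf i), (M.edge j).carrier ⊆ frontier Ω →
    ¬ (M.edge j).carrier ⊆ interface Ω₁ Ω₂ → (u i).2 j = edgeProj q (M.edge j) g
  jump : ∀ (i i' : ι) (j : κ) (h : (M.edge j).carrier ⊆ frontier (M.cell i))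
    (h' : (M.edge j).carrier ⊆ frontier (M.cell i')), M.cell i ⊆ Ω₁ → M.cell i' ⊆ Ω₂ →
      (M.edge j).carrier ⊆ interface Ω₁ Ω₂ →
        (u i).2 ⟨j, h⟩ - (u i').2 ⟨j, h'⟩ = edgeProj q (M.edge j) gD
  equation : ∀ v ∈ M.testSpace k q, M.energyForm A r u v = M.load Ω₁ Ω₂ f gN v

/-- Every nonempty set of interior edges contains an edge `e` that belongs to some element no
other edge of which lies in the set and on the straight line through `e`. -/
def CollinearityCondition (M : PolygonalMesh Ω ι κ) : Prop :=
  ∀ S : Set κ, S.Nonempty → (∀ j ∈ S, ¬ (M.edge j).carrier ⊆ frontier Ω) →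
    ∃ j ∈ S, ∃ i, (M.edge j).carrier ⊆ frontier (M.cell i) ∧
      ∀ j' ∈ S, j' ≠ j → (M.edge j').carrier ⊆ frontier (M.cell i) →
        ¬ (M.edge j').carrier ⊆ (M.edge j).line

end PolygonalMesh

end WG

end

/-! The conditions on `∂Ω ∖ Γ` and on `Γ` are met by some explicit `u₀`, and any two admissible
families differ by an element of `V_h⁰`. It remains to find `u - u₀` in the finite-dimensional space
`V_h⁰`, where `existsUnique_repr` gives existence and uniqueness as soon as the energy form is
definite. Since `a` is uniformly positive definite, the point is that `v ∈ V_h⁰` with `∇_w v = 0` on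
every element is zero (`eq_zero_of_weakGrad_eq_zero`).

By the divergence theorem, `∇_w v = 0` on `T` means `(∇v₀, φ)_T + ⟨v_b - v₀, φ·n⟩_{∂T} = 0` for all
`φ ∈ [P_r(T)]²` (`weakGradRhs_eq`). The degree of `r` leaves room for bubble functions. Each edge
has a weight that vanishes exactly on its line and is nonnegative on `T`: plus or minus the signed
distance if `T` is convex, its square otherwise. This is where `N` and `2N` come from.

Interior component: with `B` the product of all the weights, `φ = B ∇v₀` removes the boundary term
and forces `∇v₀ = 0`, so `v₀ = c_T`.

Boundary component: for an edge `e` let `φ = B p(τ) n_e`, where `B` contains only the weights of the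
edges off the line of `e`, `τ` is the affine coordinate along that line and `p` is a polynomial in
one variable. Only edges on this line contribute. If `v_b` is constant on all of them except `e`, a
nonzero `p` of degree at most `q` plus the number of these other edges makes every contribution
nonnegative (`exists_mul_nonneg_on_intervals`). The sum being zero, each contribution vanishes, and
`v_b = c_T` on `e`.

The collinearity condition, applied to the set of interior edges where `v_b` is not constant, shows
that this set is empty. Hence the previous argument applies to all edges, and `v_b = c_T` on all of
`∂T`. Single-valuedness and the zero boundary values turn the `c_T` into a piecewise constant
function without jumps that is zero at `∂Ω`. Following it along a line that avoids all vertices, out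
of the domain, gives `c_T = 0`.

The same slicing by lines parallel to the axes proves the divergence theorem: on almost every line
the one-dimensional fundamental theorem applies, and Fubini's theorem adds up the lines. -/

noncomputable section

namespace WG

/-! ## Real functions and polynomials of one variable -/

/-- A function on the line that has a limit value near each point, the point itself excluded, has
the same limit value near all points. -/
theorem exists_eventually_eq_of_punctured {α : Type*} (D : ℝ → α)
    (h : ∀ x, ∃ c, ∀ᶠ y in 𝓝[≠] x, D y = c) : ∃ c, ∀ x, ∀ᶠ y in 𝓝[≠] x, D y = c := by
  choose c hc using h
  have hloc : IsLocallyConstant c := by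
    rw [IsLocallyConstant.iff_eventually_eq]
    intro x
    have h1 := eventually_eventually_nhdsWithin.2 (hc x)
    rw [eventually_nhdsWithin_iff] at h1
    filter_upwards [h1] with y hy
    by_cases hyx : y = x
    · rw [hyx]
    -- Near `y ≠ x` the function is equal to `c x` and, off `y`, also to `c y`; punctured
    -- neighbourhoods are nonempty, so these values agree.
    · have h2 : ∀ᶠ z in 𝓝[≠] y, D z = c x := by
        have h3 := hy hyx
        rw [isOpen_compl_singleton.nhdsWithin_eq hyx] at h3
        exact h3.filter_mono nhdsWithin_le_nhds
      obtain ⟨z, hz, hz'⟩ := (h2.and (hc y)).exists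
      exact hz'.symm.trans hz
  refine ⟨c 0, fun x => ?_⟩
  rw [hloc.apply_eq_of_isPreconnected isPreconnected_univ (mem_univ 0) (mem_univ x)]
  exact hc x

theorem pos_or_neg_of_isPreconnected {X : Type*} [TopologicalSpace X] {s : Set X}
    (hs : IsPreconnected s) {φ : X → ℝ} (hφ : ContinuousOn φ s) (h0 : ∀ x ∈ s, φ x ≠ 0) :
    (∀ x ∈ s, 0 < φ x) ∨ ∀ x ∈ s, φ x < 0 := by
  by_contra! hcon
  obtain ⟨⟨x, hx, hx'⟩, y, hy, hy'⟩ := hcon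
  obtain ⟨z, hz, hz'⟩ := hs.intermediate_value hx hy hφ ⟨hx', hy'⟩
  exact h0 z hz hz'

/-- The fundamental theorem of calculus on a bounded open subset of the line whose boundary is
contained in a finite set of points `p j` at each of which the set lies on one side: on the left
if `σ j = 1` and on the right if `σ j = -1`. -/
theorem setIntegral_deriv_eq_sum {κ : Type*} (J : Finset κ) {p σ : κ → ℝ}
    (hp : Set.InjOn p J) {U : Set ℝ} (hU : IsOpen U) (hb : Bornology.IsBounded U)
    (hfr : ∀ x, (∀ j ∈ J, p j ≠ x) → ∀ᶠ y in 𝓝 x, (y ∈ U ↔ x ∈ U))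
    (hside : ∀ j ∈ J,
      (σ j = 1 ∧ (∀ᶠ y in 𝓝 (p j), (y < p j → y ∈ U) ∧ (p j < y → y ∉ U))) ∨
      (σ j = -1 ∧ (∀ᶠ y in 𝓝 (p j), (y < p j → y ∉ U) ∧ (p j < y → y ∈ U))))
    {F F' : ℝ → ℝ} (hF : ∀ x, HasDerivAt F (F' x) x) (hF' : Continuous F') :
    ∫ x in U, F' x = ∑ j ∈ J, σ j * F (p j) := by
  classical
  -- The jumps of the indicator of `U` at the points `p j` are cancelled by those of the step
  -- functions, so `D` is one constant away from these points. It is zero far to the right, hence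
  -- zero almost everywhere.
  set D : ℝ → ℝ := fun x => U.indicator 1 x - ∑ j ∈ J, σ j * (Iio (p j)).indicator 1 x with hD
  have hstep : ∀ a x : ℝ, a ≠ x →
      ∀ᶠ y in 𝓝 x, (Iio a).indicator (1 : ℝ → ℝ) y = (Iio a).indicator 1 x := by
    intro a x hax
    rcases lt_or_gt_of_ne hax with h | h
    · filter_upwards [lt_mem_nhds h] with y hy
      rw [indicator_of_notMem, indicator_of_notMem] <;> simp [h.le, hy.le]
    · filter_upwards [gt_mem_nhds h] with y hy
      rw [indicator_of_mem, indicator_of_mem] <;> simp [h, hy]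
  have hoff : ∀ x, (∀ j ∈ J, p j ≠ x) → ∀ᶠ y in 𝓝 x, D y = D x := by
    intro x hx
    have h2 : ∀ᶠ y in 𝓝 x, ∀ j ∈ J,
        (Iio (p j)).indicator (1 : ℝ → ℝ) y = (Iio (p j)).indicator 1 x :=
      (Filter.eventually_all_finset J).2 fun j hj => hstep _ _ (hx j hj)
    filter_upwards [hfr x hx, h2] with y hy hy2
    simp only [hD]
    rw [Finset.sum_congr rfl fun j hj => by rw [hy2 j hj]]
    congr 1
    by_cases hxU : x ∈ U
    · rw [indicator_of_mem hxU, indicator_of_mem (hy.2 hxU)]; rfl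
    · rw [indicator_of_notMem hxU, indicator_of_notMem (fun h => hxU (hy.1 h))]
  obtain ⟨c, hc⟩ := exists_eventually_eq_of_punctured D (by
    intro x
    by_cases hx : ∀ j ∈ J, p j ≠ x
    · exact ⟨_, (hoff x hx).filter_mono nhdsWithin_le_nhds⟩
    push Not at hx
    obtain ⟨j, hj, rfl⟩ := hx
    have h2 : ∀ᶠ y in 𝓝 (p j), ∀ i ∈ J.erase j,
        (Iio (p i)).indicator (1 : ℝ → ℝ) y = (Iio (p i)).indicator 1 (p j) :=
      (Filter.eventually_all_finset _).2 fun i hi => hstep _ _ fun h =>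
        (Finset.mem_erase.1 hi).1 (hp (Finset.mem_erase.1 hi).2 hj h)
    have h3 : ∀ y, D y = (U.indicator 1 y - σ j * (Iio (p j)).indicator 1 y) -
        ∑ i ∈ J.erase j, σ i * (Iio (p i)).indicator 1 y := by
      intro y
      simp only [hD]
      rw [← Finset.add_sum_erase J _ hj]; ring
    rcases hside j hj with ⟨hσ, hs⟩ | ⟨hσ, hs⟩
    · refine ⟨0 - ∑ i ∈ J.erase j, σ i * (Iio (p i)).indicator 1 (p j), ?_⟩
      rw [eventually_nhdsWithin_iff]
      filter_upwards [h2, hs] with y hy hy' hne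
      rw [h3, Finset.sum_congr rfl fun i hi => by rw [hy i hi]]
      congr 1
      rcases lt_or_gt_of_ne hne with h | h
      · rw [indicator_of_mem (hy'.1 h), indicator_of_mem (show y ∈ Iio (p j) from h), hσ]; simp
      · rw [indicator_of_notMem (hy'.2 h), indicator_of_notMem (by simpa using h.le)]; simp
    · refine ⟨1 - ∑ i ∈ J.erase j, σ i * (Iio (p i)).indicator 1 (p j), ?_⟩
      rw [eventually_nhdsWithin_iff]
      filter_upwards [h2, hs] with y hy hy' hne
      rw [h3, Finset.sum_congr rfl fun i hi => by rw [hy i hi]]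
      congr 1
      rcases lt_or_gt_of_ne hne with h | h
      · rw [indicator_of_notMem (hy'.1 h), indicator_of_mem (show y ∈ Iio (p j) from h), hσ]; simp
      · rw [indicator_of_mem (hy'.2 h), indicator_of_notMem (by simpa using h.le)]; simp)
  have hval : ∀ x, (∀ j ∈ J, p j ≠ x) → D x = c := by
    intro x hx
    obtain ⟨y, hy, hy'⟩ := (((hoff x hx).filter_mono nhdsWithin_le_nhds).and (hc x)).exists
    exact hy.symm.trans hy'
  obtain ⟨R, hR⟩ : ∃ R : ℝ, U ⊆ Ioo (-R) R ∧ ∀ j ∈ J, p j ∈ Ioo (-R) R := by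
    obtain ⟨R, hR⟩ := (hb.union (J.finite_toSet.image p).isBounded).subset_ball_lt 0 0
    obtain ⟨-, hR⟩ := hR
    rw [Real.ball_eq_Ioo, zero_sub, zero_add, union_subset_iff] at hR
    exact ⟨R, hR.1, fun j hj => hR.2 ⟨j, hj, rfl⟩⟩
  have hc0 : c = 0 := by
    rw [← hval R fun j hj h => absurd (hR.2 j hj).2 (by rw [h]; exact lt_irrefl R)]
    simp only [hD]
    rw [indicator_of_notMem fun h => lt_irrefl R (hR.1 h).2, Finset.sum_eq_zero, sub_zero]
    intro j hj
    rw [indicator_of_notMem (by simpa using (hR.2 j hj).2.le), mul_zero]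
  -- Reading `D` far to the left, where all step functions are one. This removes the terms `F (-R)`
  -- at the end.
  have hσ : ∑ j ∈ J, σ j = 0 := by
    have h1 := hval (-R) fun j hj h => absurd (hR.2 j hj).1 (by rw [h]; exact lt_irrefl (-R))
    simp only [hD] at h1
    rw [indicator_of_notMem fun h => lt_irrefl (-R) (hR.1 h).1, hc0, zero_sub, neg_eq_zero] at h1
    rw [← h1]
    refine Finset.sum_congr rfl fun j hj => ?_
    rw [indicator_of_mem (show -R ∈ Iio (p j) from (hR.2 j hj).1)]; simp
  have hint : ∀ a b, IntervalIntegrable F' volume a b := fun a b => hF'.intervalIntegrable a b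
  have hR0 : ∀ j ∈ J, -R ≤ p j := fun j hj => (hR.2 j hj).1.le
  have hae : ∀ᵐ x, (U.indicator F' x) =
      ∑ j ∈ J, σ j * (Iio (p j)).indicator (fun x => F' x) x := by
    have hfin : (p '' (J : Set κ)).Finite := J.finite_toSet.image p
    filter_upwards [hfin.countable.ae_notMem volume] with x hx
    have h1 := hval x fun j hj h => hx ⟨j, hj, h⟩
    rw [hc0, hD, sub_eq_zero] at h1
    have h2 : U.indicator F' x = U.indicator 1 x * F' x := by
      by_cases hxU : x ∈ U <;> simp [hxU]
    rw [h2, h1, Finset.sum_mul]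
    refine Finset.sum_congr rfl fun j _ => ?_
    by_cases hxU : x < p j
    · rw [indicator_of_mem (show x ∈ Iio (p j) from hxU),
        indicator_of_mem (show x ∈ Iio (p j) from hxU)]; simp
    · rw [indicator_of_notMem (show x ∉ Iio (p j) from hxU),
        indicator_of_notMem (show x ∉ Iio (p j) from hxU)]; simp
  have hU' : ∫ x in U, F' x = ∫ x in Ioc (-R) R, U.indicator F' x := by
    rw [setIntegral_indicator hU.measurableSet,
      inter_eq_self_of_subset_right (hR.1.trans Ioo_subset_Ioc_self)]
  have hI : ∀ j ∈ J, ∫ x in Ioc (-R) R, (Iio (p j)).indicator (fun x => F' x) x =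
      F (p j) - F (-R) := by
    intro j hj
    rw [setIntegral_indicator measurableSet_Iio, ← intervalIntegral.integral_eq_sub_of_hasDerivAt
      (fun x _ => hF x) (hint _ _), intervalIntegral.integral_of_le (hR0 j hj),
      integral_Ioc_eq_integral_Ioo]
    congr 2
    ext x
    simp only [mem_inter_iff, mem_Ioc, mem_Iio, mem_Ioo]
    exact ⟨fun h => ⟨h.1.1, h.2⟩, fun h => ⟨⟨h.1, (h.2.trans (hR.2 j hj).2).le⟩, h.2⟩⟩
  rw [hU', integral_congr_ae (ae_restrict_of_ae hae), integral_finsetSum]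
  · rw [Finset.sum_congr rfl fun j hj => by rw [integral_const_mul, hI j hj]]
    simp only [mul_sub]
    rw [Finset.sum_sub_distrib, ← Finset.sum_mul, hσ, zero_mul, sub_zero]
  · intro j _
    exact ((hF'.integrableOn_Ioc).indicator measurableSet_Iio).const_mul _

open Polynomial in
/-- A real polynomial can be multiplied by a polynomial of at most the same degree so that the
product does not change its sign on a given interval. -/
theorem exists_mul_constant_sign (w : ℝ[X]) (l u : ℝ) :
    ∃ p : ℝ[X], p.natDegree ≤ w.natDegree ∧ (∀ t ≤ l, 0 < p.eval t) ∧
      (∀ t ≥ u, p.eval t ≠ 0) ∧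
      ((∀ t ∈ Ioo l u, 0 ≤ p.eval t * w.eval t) ∨ ∀ t ∈ Ioo l u, p.eval t * w.eval t ≤ 0) := by
  induction h : w.natDegree using Nat.strong_induction_on generalizing w with
  | _ n ih =>
    by_cases hroot : ∃ ρ ∈ Ioo l u, w.eval ρ = 0
    · by_cases hw : w = 0
      · exact ⟨1, by simp, by simp, by simp, by simp [hw]⟩
      obtain ⟨ρ, hρ, hρ'⟩ := hroot
      obtain ⟨w', rfl⟩ := dvd_iff_isRoot.2 hρ'
      have hw' : w' ≠ 0 := right_ne_zero_of_mul hw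
      rw [natDegree_mul (X_sub_C_ne_zero ρ) hw', natDegree_X_sub_C] at h
      obtain ⟨p, hp, hl, hu, hs⟩ := ih _ (by omega) w' rfl
      -- Each root in the interval is doubled, so the product no longer changes sign there. The
      -- orientation `ρ - t` keeps the factor positive to the left of the interval.
      refine ⟨(C ρ - X) * p, ?_, fun t ht => ?_, fun t ht => ?_, ?_⟩
      · refine natDegree_mul_le.trans ?_
        have : (C ρ - X : ℝ[X]).natDegree ≤ 1 := (natDegree_sub_le _ _).trans (by simp)
        omega
      · rw [eval_mul]
        exact mul_pos (by simpa using ht.trans_lt hρ.1) (hl t ht)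
      · rw [eval_mul]
        refine mul_ne_zero ?_ (hu t ht)
        have := hρ.2.trans_le ht
        simpa using by linarith
      · have key : ∀ t, eval t ((C ρ - X) * p) * eval t ((X - C ρ) * w') =
            -((t - ρ) ^ 2 * (p.eval t * w'.eval t)) := fun t => by simp; ring
        rcases hs with hs | hs
        · refine Or.inr fun t ht => ?_
          rw [key]
          have := mul_nonneg (sq_nonneg (t - ρ)) (hs t ht)
          linarith
        · refine Or.inl fun t ht => ?_
          rw [key]
          have := mul_nonneg (sq_nonneg (t - ρ)) (neg_nonneg.2 (hs t ht))
          linarith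
    · push Not at hroot
      refine ⟨1, by simp, by simp, by simp, ?_⟩
      rcases pos_or_neg_of_isPreconnected isPreconnected_Ioo w.continuous.continuousOn hroot
        with h' | h'
      · exact Or.inl fun t ht => by simpa using (h' t ht).le
      · exact Or.inr fun t ht => by simpa using (h' t ht).le

open Polynomial in
/-- For polynomials `w j` on disjoint intervals there is a nonzero polynomial `p` of controlled
degree such that `p * w j` is nonnegative on the `j`-th interval. -/
theorem exists_mul_nonneg_on_intervals {κ : Type*} [DecidableEq κ] (J : Finset κ) (l u : κ → ℝ)
    (hlu : ∀ j ∈ J, l j < u j)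
    (hdisj : ∀ i ∈ J, ∀ j ∈ J, i ≠ j → Disjoint (Ioo (l i) (u i)) (Ioo (l j) (u j)))
    (w : κ → ℝ[X]) :
    ∃ p : ℝ[X], p ≠ 0 ∧ p.natDegree ≤ (J.card - 1) + ∑ j ∈ J, (w j).natDegree ∧
      ∀ j ∈ J, ∀ t ∈ Ioo (l j) (u j), 0 ≤ p.eval t * (w j).eval t := by
  -- Nonvanishing to the right of all intervals replaces `p ≠ 0`, to make the induction work:
  -- intervals are added from left to right, and `p` then has one sign on and beyond the new
  -- interval.
  suffices H : ∃ p : ℝ[X], p.natDegree ≤ (J.card - 1) + ∑ j ∈ J, (w j).natDegree ∧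
      (∀ x, (∀ j ∈ J, u j ≤ x) → p.eval x ≠ 0) ∧
      ∀ j ∈ J, ∀ t ∈ Ioo (l j) (u j), 0 ≤ p.eval t * (w j).eval t by
    obtain ⟨p, h1, h2, h3⟩ := H
    refine ⟨p, ?_, h1, h3⟩
    rintro rfl
    obtain ⟨R, hR⟩ := (J.image u).bddAbove
    exact h2 R (fun j hj => hR (by simpa using ⟨j, hj, rfl⟩)) (by simp)
  induction J using Finset.induction_on_max_value l with
  | empty => exact ⟨1, by simp, by simp, by simp⟩
  | insert a J haJ hmax ih =>
    obtain ⟨p, hdeg, hlast, hpos⟩ := ih (fun j hj => hlu j (Finset.mem_insert_of_mem hj))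
      fun i hi j hj => hdisj i (Finset.mem_insert_of_mem hi) j (Finset.mem_insert_of_mem hj)
    have hua : ∀ j ∈ J, u j ≤ l a := by
      intro j hj
      by_contra! hcon
      have hd := hdisj j (Finset.mem_insert_of_mem hj) a (Finset.mem_insert_self _ _)
        (fun h => haJ (h ▸ hj))
      have h1 := hmax j hj
      have h2 := hlu a (Finset.mem_insert_self _ _)
      obtain ⟨t, ht, ht'⟩ := exists_between (lt_min hcon h2)
      exact Set.disjoint_left.1 hd ⟨h1.trans_lt ht, ht'.trans_le (min_le_left _ _)⟩
        ⟨ht, ht'.trans_le (min_le_right _ _)⟩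
    obtain ⟨s, hsdeg, hsl, hsu, hs⟩ := exists_mul_constant_sign (w a) (l a) (u a)
    have hp : ∀ t ∈ Ici (l a), p.eval t ≠ 0 := fun t ht => hlast t fun j hj => (hua j hj).trans ht
    -- `g` corrects the sign on the new interval without changing it on the earlier ones. The degree
    -- bound is `0` for the first interval, where a constant will do, and `1` for each later one;
    -- this gives `J.card - 1` in total.
    obtain ⟨g, hgdeg, hgl, hgu, hg⟩ : ∃ g : ℝ[X], g.natDegree ≤ J.card - (J.card - 1) ∧
        (∀ j ∈ J, ∀ t < u j, 0 < g.eval t) ∧ (∀ t ≥ u a, g.eval t ≠ 0) ∧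
        ∀ t ∈ Ioo (l a) (u a), 0 ≤ g.eval t * (p.eval t * (s.eval t * (w a).eval t)) := by
      have hla := hlu a (Finset.mem_insert_self _ _)
      have hcases : (∀ t ∈ Ioo (l a) (u a), 0 ≤ p.eval t * (s.eval t * (w a).eval t)) ∨
          ∀ t ∈ Ioo (l a) (u a), p.eval t * (s.eval t * (w a).eval t) ≤ 0 := by
        rcases pos_or_neg_of_isPreconnected isPreconnected_Ici p.continuous.continuousOn hp
          with h | h <;> rcases hs with hs | hs
        · exact Or.inl fun t ht => mul_nonneg (h t ht.1.le).le (hs t ht)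
        · exact Or.inr fun t ht => mul_nonpos_of_nonneg_of_nonpos (h t ht.1.le).le (hs t ht)
        · exact Or.inr fun t ht => mul_nonpos_of_nonpos_of_nonneg (h t ht.1.le).le (hs t ht)
        · exact Or.inl fun t ht => mul_nonneg_of_nonpos_of_nonpos (h t ht.1.le).le (hs t ht)
      rcases hcases with h | h
      · exact ⟨1, by simp, by simp, by simp, by simpa using h⟩
      rcases J.eq_empty_or_nonempty with rfl | hJ
      · exact ⟨-1, by simp, by simp, by simp, by simpa using h⟩
      -- A sign change exactly at the left end of the new interval: positive on all earlier
      -- intervals, negative on the new one.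
      refine ⟨C (l a) - X, ?_, fun j hj t ht => ?_, fun t ht => ?_, fun t ht => ?_⟩
      · have := hJ.card_pos
        have : (C (l a) - X : ℝ[X]).natDegree ≤ 1 := (natDegree_sub_le _ _).trans (by simp)
        omega
      · simpa using ht.trans_le (hua j hj)
      · have := hla.trans_le ht
        simpa using by linarith
      · exact mul_nonneg_of_nonpos_of_nonpos (by simpa using ht.1.le) (h t ht)
    refine ⟨g * (s * p), ?_, fun x hx => ?_, fun j hj t ht => ?_⟩
    · rw [Finset.card_insert_of_notMem haJ, Finset.sum_insert haJ]
      refine natDegree_mul_le.trans ?_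
      have := natDegree_mul_le (p := s) (q := p)
      omega
    · have hx' := hx a (Finset.mem_insert_self _ _)
      have h2 := hlu a (Finset.mem_insert_self _ _)
      rw [eval_mul, eval_mul]
      exact mul_ne_zero (hgu x hx') (mul_ne_zero (hsu x hx') (hp x (h2.le.trans hx')))
    · rw [eval_mul, eval_mul]
      rcases Finset.mem_insert.1 hj with rfl | hj
      · have := hg t ht
        nlinarith [hg t ht]
      · have h1 := mul_nonneg (mul_nonneg (hgl j hj t ht.2).le
          (hsl t (ht.2.le.trans (hua j hj))).le) (hpos j hj t ht)
        linarith

/-! ## Edges and half planes -/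

namespace Edge

theorem carrier_eq_image (e : Edge) : e.carrier = e.point '' Icc (0 : ℝ) 1 :=
  segment_eq_image' ℝ e.a e.b

theorem relInterior_eq_image (e : Edge) : e.relInterior = e.point '' Ioo (0 : ℝ) 1 :=
  openSegment_eq_image' ℝ e.a e.b

theorem relInterior_subset_carrier (e : Edge) : e.relInterior ⊆ e.carrier :=
  openSegment_subset_segment ℝ e.a e.b

theorem isClosed_carrier (e : Edge) : IsClosed e.carrier := by
  rw [carrier_eq_image]
  exact (isCompact_Icc.image e.continuous_point).isClosed

theorem point_apply (e : Edge) (t : ℝ) (l : Fin 2) :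
    e.point t l = e.a l + t * (e.b l - e.a l) := by
  simp [point]

theorem mem_relInterior_point (e : Edge) : e.point 2⁻¹ ∈ e.relInterior := by
  rw [relInterior_eq_image]
  exact mem_image_of_mem _ ⟨by norm_num, by norm_num⟩

theorem a_notMem_relInterior (e : Edge) : e.a ∉ e.relInterior := fun h =>
  e.ne (left_mem_openSegment_iff.1 h)

theorem b_notMem_relInterior (e : Edge) : e.b ∉ e.relInterior := fun h =>
  e.ne (right_mem_openSegment_iff.1 h)

theorem point_injective (e : Edge) : Function.Injective e.point := by
  intro s t h
  have h1 : (s - t) • (e.b - e.a) = 0 := by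
    rw [sub_smul, sub_eq_zero]
    exact add_left_cancel h
  rcases smul_eq_zero.1 h1 with h1 | h1
  · linarith
  · exact absurd (sub_eq_zero.1 h1).symm e.ne

theorem length_sq (e : Edge) :
    e.length ^ 2 = (e.b 0 - e.a 0) ^ 2 + (e.b 1 - e.a 1) ^ 2 := by
  unfold length
  rw [EuclideanSpace.dist_eq, Real.sq_sqrt (by positivity), Fin.sum_univ_two, Real.dist_eq,
    Real.dist_eq, sq_abs, sq_abs]
  ring

theorem normal_zero (e : Edge) : e.normal 0 = -(e.b 1 - e.a 1) / e.length := by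
  simp [normal]; field_simp

theorem normal_one (e : Edge) : e.normal 1 = (e.b 0 - e.a 0) / e.length := by
  simp [normal]; field_simp

theorem normal_sq (e : Edge) : e.normal 0 ^ 2 + e.normal 1 ^ 2 = 1 := by
  have := e.length_pos
  rw [normal_zero, normal_one, div_pow, div_pow, ← add_div, div_eq_one_iff_eq (by positivity),
    length_sq]
  ring

/-- The signed distance from the straight line through the edge. -/
def height (e : Edge) (y : Pt) : ℝ :=
  e.normal 0 * (y 0 - e.a 0) + e.normal 1 * (y 1 - e.a 1)

theorem continuous_height (e : Edge) : Continuous e.height := by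
  unfold height
  fun_prop

theorem height_point (e : Edge) (t : ℝ) : e.height (e.point t) = 0 := by
  unfold height
  have := e.length_pos
  rw [point_apply, point_apply, normal_zero, normal_one]
  field_simp
  ring

theorem height_add_smul (e : Edge) (x v : Pt) (t : ℝ) :
    e.height (x + t • v) = e.height x + t * (e.normal 0 * v 0 + e.normal 1 * v 1) := by
  unfold height
  simp only [PiLp.add_apply, PiLp.smul_apply, smul_eq_mul]
  ring

theorem height_combo (e : Edge) (x y : Pt) {s t : ℝ} (h : s + t = 1) :
    e.height (s • x + t • y) = s * e.height x + t * e.height y := by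
  obtain rfl : s = 1 - t := by linarith
  unfold height
  simp only [PiLp.add_apply, PiLp.smul_apply, smul_eq_mul]
  ring

theorem height_add_normal (e : Edge) (x : Pt) (t : ℝ) :
    e.height (x + t • e.normal) = e.height x + t := by
  rw [height_add_smul]
  linear_combination t * e.normal_sq

theorem exists_point_eq_of_height_eq_zero (e : Edge) {y : Pt} (h : e.height y = 0) :
    ∃ t, e.point t = y := by
  have hl := e.length_pos
  have hsq := e.length_sq
  -- The parameter of the orthogonal projection of `y` onto the line.
  refine ⟨((y 0 - e.a 0) * (e.b 0 - e.a 0) + (y 1 - e.a 1) * (e.b 1 - e.a 1)) / e.length ^ 2, ?_⟩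
  have h' : -(e.b 1 - e.a 1) * (y 0 - e.a 0) + (e.b 0 - e.a 0) * (y 1 - e.a 1) = 0 := by
    have h1 := h
    unfold height at h1
    rw [normal_zero, normal_one] at h1
    field_simp at h1
    linarith
  ext l
  rw [point_apply]
  fin_cases l
  · simp only [Fin.zero_eta]
    field_simp
    linear_combination (e.a 0 - y 0) * hsq + (e.b 1 - e.a 1) * h'
  · simp only [Fin.mk_one]
    field_simp
    linear_combination (e.a 1 - y 1) * hsq - (e.b 0 - e.a 0) * h'

theorem mem_line_iff (e : Edge) {y : Pt} : y ∈ e.line ↔ e.height y = 0 := by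
  have key : ∀ t : ℝ, AffineMap.lineMap e.a e.b t = e.point t := fun t => by
    simp [AffineMap.lineMap_apply, point, add_comm]
  constructor
  · intro h
    obtain ⟨t, rfl⟩ := _root_.mem_affineSpan_pair_iff_exists_lineMap_eq.1 h
    rw [key, height_point]
  · intro h
    obtain ⟨t, rfl⟩ := e.exists_point_eq_of_height_eq_zero h
    rw [← key]
    exact AffineMap.lineMap_mem_affineSpan_pair _ _ _

open Classical in
/-- The sign with which `e.normal` has to be multiplied to point out of `S`. -/
def side (e : Edge) (S : Set Pt) : ℝ := if e.SideIs e.normal S then -1 else 1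

theorem side_eq (e : Edge) (S : Set Pt) : e.side S = 1 ∨ e.side S = -1 := by
  unfold side
  split_ifs <;> simp

theorem outwardNormal_apply (e : Edge) (S : Set Pt) (l : Fin 2) :
    e.outwardNormal S l = e.side S * e.normal l := by
  unfold outwardNormal side
  split_ifs <;> simp

end Edge

/-! ### Polygons near a relatively interior point of an edge -/

theorem subset_or_disjoint_of_disjoint_frontier {X : Type*} [TopologicalSpace X]
    {t S : Set X} (ht : IsPreconnected t) (hS : IsOpen S) (hd : Disjoint t (frontier S)) :
    t ⊆ S ∨ Disjoint t S := by
  have h1 : t ⊆ S ∪ (closure S)ᶜ := by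
    intro x hx
    by_cases hxS : x ∈ S
    · exact Or.inl hxS
    · refine Or.inr fun hc => Set.disjoint_left.1 hd hx ?_
      rw [hS.frontier_eq]
      exact ⟨hc, hxS⟩
  by_cases hne : (t ∩ S).Nonempty
  · refine Or.inl (ht.subset_left_of_subset_union hS isClosed_closure.isOpen_compl ?_ h1 hne)
    exact disjoint_compl_right.mono_left subset_closure
  · exact Or.inr (Set.disjoint_iff_inter_eq_empty.2 (Set.not_nonempty_iff_eq_empty.1 hne))

/-- Distinct edges of the family meet at most in common endpoints. -/
def EdgesMeetInEndpoints {κ : Type*} (edge : κ → Edge) : Prop :=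
  ∀ j j', j ≠ j' → (edge j).carrier ∩ (edge j').carrier ⊆
    {(edge j).a, (edge j).b} ∩ {(edge j').a, (edge j').b}

section Family

variable {κ : Type*} {edge : κ → Edge} {S : Set Pt}

theorem EdgesMeetInEndpoints.eq_of_mem (hE : EdgesMeetInEndpoints edge) {j j' : κ} {z : Pt}
    (hz : z ∈ (edge j).relInterior) (hz' : z ∈ (edge j').carrier) : j = j' := by
  by_contra hne
  have h := (hE j j' hne ⟨(edge j).relInterior_subset_carrier hz, hz'⟩).1
  rcases h with rfl | h
  · exact (edge j).a_notMem_relInterior hz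
  · rw [mem_singleton_iff] at h
    exact (edge j).b_notMem_relInterior (h ▸ hz)

theorem IsPolygon.exists_edge (hS : IsPolygon edge S) {z : Pt} (hz : z ∈ frontier S) :
    ∃ j, (edge j).carrier ⊆ frontier S ∧ z ∈ (edge j).carrier := by
  rw [hS.frontier_eq] at hz
  simp only [mem_iUnion, mem_ofPred_eq, exists_prop] at hz
  exact hz

theorem IsPolygon.carrier_subset_frontier (hE : EdgesMeetInEndpoints edge)
    (hS : IsPolygon edge S) {j : κ} {z : Pt} (hz : z ∈ (edge j).relInterior)
    (hz' : z ∈ frontier S) : (edge j).carrier ⊆ frontier S := by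
  obtain ⟨j', hj', hzj'⟩ := hS.exists_edge hz'
  rwa [hE.eq_of_mem hz hzj']

theorem EdgesMeetInEndpoints.eventually_eq [Finite κ] (hE : EdgesMeetInEndpoints edge) {j : κ}
    {z : Pt} (hz : z ∈ (edge j).relInterior) :
    ∀ᶠ y in 𝓝 z, ∀ j', y ∈ (edge j').carrier → j' = j := by
  refine eventually_all.2 fun j' => ?_
  by_cases h : j' = j
  · exact Eventually.of_forall fun _ _ => h
  · have h1 : z ∉ (edge j').carrier := fun h' => h (hE.eq_of_mem hz h').symm
    filter_upwards [(edge j').isClosed_carrier.isOpen_compl.mem_nhds h1] with y hy hy'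
    exact absurd hy' hy

theorem convex_halfBall (e : Edge) (z : Pt) (ε s : ℝ) :
    Convex ℝ (Metric.ball z ε ∩ {y | s * e.height y < 0}) := by
  refine (convex_ball z ε).inter ?_
  intro x hx y hy α β hα hβ hαβ
  simp only [mem_ofPred_eq] at *
  rw [e.height_combo _ _ hαβ]
  rcases hα.eq_or_lt with rfl | hα
  · obtain rfl : β = 1 := by linarith
    linarith
  · nlinarith

/-- Near a relatively interior point of an edge, each of the two sides of the edge belongs to the
polygon or is disjoint from it. -/
theorem IsPolygon.exists_halfBall [Finite κ] (hE : EdgesMeetInEndpoints edge) {j : κ} {z : Pt}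
    (hz : z ∈ (edge j).relInterior) : ∃ ε > 0, ∀ S, IsPolygon edge S → ∀ s : ℝ, s ≠ 0 →
      (Metric.ball z ε ∩ {y | s * (edge j).height y < 0} ⊆ S ∨
        Disjoint (Metric.ball z ε ∩ {y | s * (edge j).height y < 0}) S) := by
  -- The radius depends only on the finite family of edges, so it serves all polygons at once. A
  -- half ball of this radius misses every edge, hence the boundary of every polygon, and it is
  -- connected.
  obtain ⟨ε, hε, hb⟩ := Metric.eventually_nhds_iff_ball.1 (hE.eventually_eq hz)
  refine ⟨ε, hε, fun S hS s hs => ?_⟩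
  refine subset_or_disjoint_of_disjoint_frontier
    (convex_halfBall _ _ _ _).isPreconnected hS.isOpen ?_
  rw [Set.disjoint_left]
  rintro y ⟨hy, hy'⟩ hyf
  obtain ⟨j', -, hyj'⟩ := hS.exists_edge hyf
  obtain rfl := hb y hy j' hyj'
  rw [Edge.carrier_eq_image] at hyj'
  obtain ⟨t, -, rfl⟩ := hyj'
  rw [mem_ofPred_eq, Edge.height_point, mul_zero] at hy'
  exact lt_irrefl _ hy'

/-- The value `1` of `side` is a default that is also taken if `S` lies on neither side; `one_sided`
excludes this for edges in the boundary. -/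
theorem IsPolygon.sideIs_side (hS : IsPolygon edge S) {j : κ}
    (hj : (edge j).carrier ⊆ frontier S) :
    (edge j).SideIs (-((edge j).side S) • (edge j).normal) S := by
  unfold Edge.side
  split_ifs with h
  · simpa using h
  · simpa using (hS.one_sided j hj).resolve_left h

/-- Near a relatively interior point of an edge in its boundary, a polygon consists of the points
on one side of that edge. -/
theorem IsPolygon.eventually_side [Finite κ] (hE : EdgesMeetInEndpoints edge)
    (hS : IsPolygon edge S) {j : κ} (hj : (edge j).carrier ⊆ frontier S) {z : Pt}
    (hz : z ∈ (edge j).relInterior) :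
    ∀ᶠ y in 𝓝 z, ((edge j).side S * (edge j).height y < 0 → y ∈ S) ∧
      (0 < (edge j).side S * (edge j).height y → y ∉ S) := by
  obtain ⟨ε, hε, hball⟩ := IsPolygon.exists_halfBall hE hz
  set σ := (edge j).side S with hσ
  have hσ1 : σ = 1 ∨ σ = -1 := (edge j).side_eq S
  have hσ0 : σ ≠ 0 := by rcases hσ1 with h | h <;> rw [h] <;> norm_num
  have hσσ : σ * σ = 1 := by rcases hσ1 with h | h <;> rw [h] <;> norm_num
  have hz0 : (edge j).height z = 0 := by
    rw [Edge.relInterior_eq_image] at hz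
    obtain ⟨t, -, rfl⟩ := hz
    exact Edge.height_point _ _
  have hside := hS.sideIs_side hj z hz
  have hnear : ∀ᶠ t : ℝ in 𝓝[>] 0, z + t • (-σ • (edge j).normal) ∈ Metric.ball z ε ∧
      z - t • (-σ • (edge j).normal) ∈ Metric.ball z ε := by
    refine Filter.Eventually.filter_mono nhdsWithin_le_nhds (Eventually.and ?_ ?_)
    · have hc : Continuous fun t : ℝ => z + t • (-σ • (edge j).normal) := by fun_prop
      exact hc.continuousAt.eventually_mem (by simpa using Metric.ball_mem_nhds z hε)
    · have hc : Continuous fun t : ℝ => z - t • (-σ • (edge j).normal) := by fun_prop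
      exact hc.continuousAt.eventually_mem (by simpa using Metric.ball_mem_nhds z hε)
  -- One point on each side of the edge decides, for the whole half ball containing it, which
  -- alternative of `exists_halfBall` holds.
  obtain ⟨t, ⟨⟨hin, hout⟩, hbin, hbout⟩, ht⟩ :=
    ((hside.and hnear).and self_mem_nhdsWithin).exists
  have ht : (0 : ℝ) < t := ht
  have hhin : (edge j).height (z + t • (-σ • (edge j).normal)) = -(σ * t) := by
    rw [smul_smul, Edge.height_add_normal, hz0]; ring
  have hhout : (edge j).height (z - t • (-σ • (edge j).normal)) = σ * t := by
    rw [sub_eq_add_neg, ← smul_neg, neg_smul, neg_neg, smul_smul, Edge.height_add_normal, hz0]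
    ring
  have h1 := (hball S hS σ hσ0).resolve_right fun hd => Set.disjoint_left.1 hd ⟨hbin, by
    rw [mem_ofPred_eq, hhin]; linear_combination (-t) * hσσ + (by linarith : -t < 0)⟩ hin
  have h2 := (hball S hS (-σ) (neg_ne_zero.2 hσ0)).resolve_left fun hd => hout (hd ⟨hbout, by
    rw [mem_ofPred_eq, hhout]; linear_combination (-t) * hσσ + (by linarith : -t < 0)⟩)
  filter_upwards [Metric.ball_mem_nhds z hε] with y hy
  exact ⟨fun h => h1 ⟨hy, h⟩, fun h hyS => Set.disjoint_left.1 h2 ⟨hy, by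
    rw [mem_ofPred_eq]; linarith⟩ hyS⟩

end Family

theorem height_eq_zero_of_mem_relInterior {e : Edge} {z : Pt} (hz : z ∈ e.relInterior) :
    e.height z = 0 := by
  rw [Edge.relInterior_eq_image] at hz
  obtain ⟨t, -, rfl⟩ := hz
  exact Edge.height_point _ _

/-- An open set that, near a point, is contained in a straight line, is empty near that point. -/
theorem notMem_closure_of_eventually_height_eq_zero {e : Edge} {z : Pt} {S : Set Pt}
    (hS : IsOpen S) (h : ∀ᶠ y in 𝓝 z, y ∈ S → e.height y = 0) : z ∉ closure S := by
  intro hz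
  have h1 := eventually_eventually_nhds.2 h
  obtain ⟨y, hyS, hy⟩ := ((mem_closure_iff_frequently.1 hz).and_eventually h1).exists
  have h2 : ∀ᶠ t : ℝ in 𝓝 0, e.height (y + t • e.normal) = 0 := by
    have hc : Continuous fun t : ℝ => y + t • e.normal := by fun_prop
    have ht : Tendsto (fun t : ℝ => y + t • e.normal) (𝓝 0) (𝓝 y) := by
      simpa using hc.tendsto 0
    exact ht.eventually (hy.and (hS.mem_nhds hyS) |>.mono fun x hx => hx.1 hx.2)
  have h0 := h2.self_of_nhds
  obtain ⟨t, ht, ht0⟩ := ((h2.filter_mono nhdsWithin_le_nhds).and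
    (self_mem_nhdsWithin : Ioi (0 : ℝ) ∈ 𝓝[>] 0)).exists
  rw [Edge.height_add_normal] at ht h0
  exact (ne_of_gt (show (0 : ℝ) < t from ht0)) (by linarith)

/-- A small displacement of `z` by `t * s` along the normal, with `t > 0`, has height `t * s`, and
`s * (t * s) > 0`. This produces the points at which descriptions of two polygons on a chosen side
are compared. -/
theorem exists_height_pos_of_eventually {e : Edge} {z : Pt} (hz : z ∈ e.relInterior)
    {P : Pt → Prop} (hP : ∀ᶠ y in 𝓝 z, P y) {s : ℝ} (hs : s ≠ 0) :
    ∃ y, P y ∧ 0 < s * e.height y := by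
  have hc : Continuous fun t : ℝ => z + t • e.normal := by fun_prop
  have ht : Tendsto (fun t : ℝ => z + t • e.normal) (𝓝 0) (𝓝 z) := by simpa using hc.tendsto 0
  have hc' : Tendsto (fun t : ℝ => t * s) (𝓝 0) (𝓝 0) := by
    simpa using (continuous_mul_const s).tendsto (0 : ℝ)
  obtain ⟨t, ht1, ht0⟩ := (((hc'.eventually (ht.eventually hP))).filter_mono
    nhdsWithin_le_nhds |>.and (self_mem_nhdsWithin : Ioi (0 : ℝ) ∈ 𝓝[>] 0)).exists
  refine ⟨_, ht1, ?_⟩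
  rw [Edge.height_add_normal, height_eq_zero_of_mem_relInterior hz, zero_add]
  have h1 : (0 : ℝ) < t := ht0
  have h2 : 0 < s ^ 2 := by positivity
  nlinarith

theorem Edge.side_ne_zero (e : Edge) (S : Set Pt) : e.side S ≠ 0 := by
  rcases e.side_eq S with h | h <;> rw [h] <;> norm_num

theorem Edge.side_eq_or_eq_neg (e : Edge) (S S' : Set Pt) :
    e.side S = e.side S' ∨ e.side S = -e.side S' := by
  rcases e.side_eq S with h | h <;> rcases e.side_eq S' with h' | h' <;> rw [h, h'] <;> norm_num

section Family

variable {κ : Type*} [Finite κ] {edge : κ → Edge} {S S' : Set Pt} {j : κ}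

/-- With opposite signs, points of `S` near the edge would lie on the side that `S'` does not
occupy. -/
theorem IsPolygon.side_eq_of_subset (hE : EdgesMeetInEndpoints edge) (hS : IsPolygon edge S)
    (hS' : IsPolygon edge S') (hj : (edge j).carrier ⊆ frontier S)
    (hj' : (edge j).carrier ⊆ frontier S') (hsub : S ⊆ S') :
    (edge j).side S = (edge j).side S' := by
  by_contra hne
  have hz := (edge j).mem_relInterior_point
  obtain ⟨y, ⟨h1, h2⟩, hy⟩ := exists_height_pos_of_eventually hz
    ((hS.eventually_side hE hj hz).and (hS'.eventually_side hE hj' hz))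
    ((edge j).side_ne_zero S')
  have h3 : (edge j).side S = -(edge j).side S' := ((edge j).side_eq_or_eq_neg S S').resolve_left hne
  refine h2.2 hy (hsub (h1.1 ?_))
  rw [h3]
  linarith

/-- With equal signs, both polygons would fill the same half neighbourhood of the edge. -/
theorem IsPolygon.side_eq_neg_of_disjoint (hE : EdgesMeetInEndpoints edge)
    (hS : IsPolygon edge S) (hS' : IsPolygon edge S') (hj : (edge j).carrier ⊆ frontier S)
    (hj' : (edge j).carrier ⊆ frontier S') (hd : Disjoint S S') :
    (edge j).side S = -(edge j).side S' := by
  by_contra hne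
  have hz := (edge j).mem_relInterior_point
  obtain ⟨y, ⟨h1, h2⟩, hy⟩ := exists_height_pos_of_eventually hz
    ((hS.eventually_side hE hj hz).and (hS'.eventually_side hE hj' hz))
    (neg_ne_zero.2 ((edge j).side_ne_zero S'))
  have h3 : (edge j).side S = (edge j).side S' := ((edge j).side_eq_or_eq_neg S S').resolve_right hne
  exact Set.disjoint_left.1 hd (h1.1 (by rw [h3]; linarith)) (h2.1 (by linarith))

end Family

/-! ## Adjacency of elements -/

namespace PolygonalMesh

variable {Ω Ω₁ Ω₂ : Set Pt} {ι κ : Type*}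

theorem edgesMeet (M : PolygonalMesh Ω ι κ) : EdgesMeetInEndpoints M.edge := M.edge_inter

theorem isInterfaceFitted_swap {M : PolygonalMesh Ω ι κ} (h : IsInterfaceFitted M Ω₁ Ω₂) :
    IsInterfaceFitted M Ω₂ Ω₁ :=
  ⟨h.isOpen₂, h.isOpen₁, h.subset₂, h.subset₁, h.disjoint.symm, by rw [h.closure_eq, union_comm],
    fun i => (h.fitted i).symm⟩

variable {M : PolygonalMesh Ω ι κ}

theorem sum_indicator_eq [Fintype ι] (M : PolygonalMesh Ω ι κ) (c : ι → ℝ) {i : ι} {y : Pt}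
    (hy : y ∈ M.cell i) : ∑ i', (M.cell i').indicator (fun _ => c i') y = c i := by
  classical
  rw [Finset.sum_eq_single i, indicator_of_mem hy]
  · intro i' _ hne
    exact indicator_of_notMem
      (fun hy' => Set.disjoint_left.1 (M.cell_disjoint i' i hne) hy' hy) _
  · simp

variable [Finite κ]

/-- An edge in the boundary of the domain does not lie in the interface. -/
theorem not_subset_interface_of_subset_frontier
    (h : IsInterfaceFitted M Ω₁ Ω₂) {j : κ} (hj : (M.edge j).carrier ⊆ frontier Ω) :
    ¬ (M.edge j).carrier ⊆ interface Ω₁ Ω₂ := by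
  intro hΓ
  obtain ⟨i, hi⟩ := M.edge_used j
  wlog hi1 : M.cell i ⊆ Ω₁ generalizing Ω₁ Ω₂
  · exact this (isInterfaceFitted_swap h) (by rwa [interface, inter_comm])
      ((h.fitted i).resolve_left hi1)
  have hz := (M.edge j).mem_relInterior_point
  -- Near the edge, one side is filled by an element in `Ω₁` and the other is outside `Ω`. Only the
  -- line itself is left for the open set `Ω₂`, which therefore does not reach the edge.
  refine notMem_closure_of_eventually_height_eq_zero (e := M.edge j) h.isOpen₂ ?_
    (hΓ ((M.edge j).relInterior_subset_carrier hz)).2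
  have hne := (M.polygon i).side_eq_of_subset M.edgesMeet M.domain hi hj (M.cell_subset i)
  filter_upwards [M.domain.eventually_side M.edgesMeet hj hz,
    (M.polygon i).eventually_side M.edgesMeet hi hz] with y hy1 hy2 hy
  by_contra h0
  rw [hne] at hy2
  rcases lt_trichotomy ((M.edge j).side Ω * (M.edge j).height y) 0 with h1 | h1 | h1
  · exact Set.disjoint_left.1 h.disjoint (hi1 (hy2.1 h1)) hy
  · exact (mul_ne_zero ((M.edge j).side_ne_zero Ω) h0) h1
  · exact hy1.2 h1 (h.subset₂ hy)

/-- The two elements at an edge in the interface do not lie in the same subdomain. -/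
theorem eq_of_subset_interface (h : IsInterfaceFitted M Ω₁ Ω₂) {j : κ}
    (hΓ : (M.edge j).carrier ⊆ interface Ω₁ Ω₂) {i i' : ι}
    (hi : (M.edge j).carrier ⊆ frontier (M.cell i))
    (hi' : (M.edge j).carrier ⊆ frontier (M.cell i')) (hi1 : M.cell i ⊆ Ω₁)
    (hi1' : M.cell i' ⊆ Ω₁) : i = i' := by
  by_contra hne
  have hz := (M.edge j).mem_relInterior_point
  -- Two different elements in `Ω₁` would fill both sides of the edge and leave only its line for
  -- `Ω₂`.
  refine notMem_closure_of_eventually_height_eq_zero (e := M.edge j) h.isOpen₂ ?_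
    (hΓ ((M.edge j).relInterior_subset_carrier hz)).2
  have hside := (M.polygon i).side_eq_neg_of_disjoint M.edgesMeet (M.polygon i') hi hi'
    (M.cell_disjoint i i' hne)
  filter_upwards [(M.polygon i').eventually_side M.edgesMeet hi' hz,
    (M.polygon i).eventually_side M.edgesMeet hi hz] with y hy1 hy2 hy
  by_contra h0
  rw [hside] at hy2
  rcases lt_trichotomy ((M.edge j).side (M.cell i') * (M.edge j).height y) 0 with h1 | h1 | h1
  · exact Set.disjoint_left.1 h.disjoint (hi1' (hy1.1 h1)) hy
  · exact (mul_ne_zero ((M.edge j).side_ne_zero _) h0) h1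
  · exact Set.disjoint_left.1 h.disjoint (hi1 (hy2.1 (by linarith))) hy

/-- A piecewise constant function takes near a relatively interior point of an edge only the value
that it has in the elements at this edge, if that value is zero for edges in the boundary. -/
theorem eventually_sum_indicator_eq [Fintype ι] {j : κ} {z : Pt}
    (hz : z ∈ (M.edge j).relInterior) (c : ι → ℝ) (d : ℝ)
    (hc : ∀ i, (M.edge j).carrier ⊆ frontier (M.cell i) → c i = d)
    (hd : (M.edge j).carrier ⊆ frontier Ω → d = 0) :
    ∀ᶠ y in 𝓝 z, (M.edge j).height y ≠ 0 →
      ∑ i, (M.cell i).indicator (fun _ => c i) y = d := by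
  have hzc := (M.edge j).relInterior_subset_carrier hz
  obtain ⟨i₀, hi₀⟩ := M.edge_used j
  have hz₀ : z ∈ closure (M.cell i₀) := frontier_subset_closure (hi₀ hzc)
  have h1 : ∀ᶠ y in 𝓝 z, ∀ i, y ∈ M.cell i → (M.edge j).carrier ⊆ frontier (M.cell i) := by
    refine eventually_all.2 fun i => ?_
    by_cases hi : (M.edge j).carrier ⊆ frontier (M.cell i)
    · exact Eventually.of_forall fun _ _ => hi
    have hzf : z ∉ frontier (M.cell i) := fun hzf =>
      hi ((M.polygon i).carrier_subset_frontier M.edgesMeet hz hzf)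
    have hzi : z ∉ M.cell i := by
      intro hzi
      obtain ⟨y, hy, hy'⟩ := mem_closure_iff.1 hz₀ _ (M.polygon i).isOpen hzi
      have hne : i ≠ i₀ := fun h => hi (h ▸ hi₀)
      exact Set.disjoint_left.1 (M.cell_disjoint i i₀ hne) hy hy'
    have hzcl : z ∉ closure (M.cell i) := by
      rw [closure_eq_self_union_frontier]
      exact fun h => h.elim hzi hzf
    filter_upwards [isClosed_closure.isOpen_compl.mem_nhds hzcl] with y hy hy'
    exact absurd (subset_closure hy') hy
  -- At a boundary edge the sum may also be empty, which gives zero, the value of `d` there. At an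
  -- interior edge it has to be shown that points off the line belong to some element.
  by_cases hj : (M.edge j).carrier ⊆ frontier Ω
  · filter_upwards [h1] with y hy _
    by_cases hcell : ∃ i, y ∈ M.cell i
    · obtain ⟨i, hi⟩ := hcell
      rw [sum_indicator_eq M c hi, hc i (hy i hi)]
    · push Not at hcell
      rw [hd hj]
      exact Finset.sum_eq_zero fun i _ => indicator_of_notMem (hcell i) _
  · have hzΩ : z ∈ Ω := by
      have h2 : z ∈ closure Ω := by
        rw [M.cover]
        exact mem_iUnion.2 ⟨i₀, hz₀⟩
      rw [closure_eq_self_union_frontier] at h2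
      exact h2.resolve_right fun h => hj (M.domain.carrier_subset_frontier M.edgesMeet hz h)
    obtain ⟨ε, hε, hball⟩ := IsPolygon.exists_halfBall M.edgesMeet hz
    filter_upwards [h1, Metric.ball_mem_nhds z hε, M.domain.isOpen.mem_nhds hzΩ]
      with y hy hyε hyΩ h0
    suffices hcell : ∃ i, y ∈ M.cell i by
      obtain ⟨i, hi⟩ := hcell
      rw [sum_indicator_eq M c hi, hc i (hy i hi)]
    have hyc : y ∈ ⋃ i, closure (M.cell i) := by
      rw [← M.cover]
      exact subset_closure hyΩ
    obtain ⟨i, hi⟩ := mem_iUnion.1 hyc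
    have hs : -(M.edge j).height y ≠ 0 := neg_ne_zero.2 h0
    -- The factor `-height y` selects the half ball that contains `y`. An element whose closure
    -- contains `y` meets this half ball and so contains all of it.
    have hyH : y ∈ Metric.ball z ε ∩ {w | -(M.edge j).height y * (M.edge j).height w < 0} := by
      refine ⟨hyε, ?_⟩
      have : 0 < (M.edge j).height y ^ 2 := by positivity
      rw [mem_ofPred_eq]
      nlinarith
    have hopen : IsOpen (Metric.ball z ε ∩
        {w | -(M.edge j).height y * (M.edge j).height w < 0}) :=
      Metric.isOpen_ball.inter (isOpen_lt ((M.edge j).continuous_height.const_mul _)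
        continuous_const)
    obtain ⟨w, hw, hwi⟩ := mem_closure_iff.1 hi _ hopen hyH
    exact ⟨i, ((hball _ (M.polygon i) _ hs).resolve_right fun hd =>
      Set.disjoint_left.1 hd hw hwi) hyH⟩

end PolygonalMesh

/-! ## Lines parallel to the coordinate axes -/

/-- The point whose `l`-th coordinate is `s` and whose other coordinate is `y`. -/
def slicePoint (l : Fin 2) (s y : ℝ) : Pt := WithLp.toLp 2 fun i => if i = l then s else y

theorem slicePoint_same (l : Fin 2) (s y : ℝ) : slicePoint l s y l = s := by
  simp [slicePoint]

theorem slicePoint_of_ne {l m : Fin 2} (h : m ≠ l) (s y : ℝ) : slicePoint l s y m = y := by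
  simp [slicePoint, h]

theorem slicePoint_eq {l m : Fin 2} (h : m ≠ l) (z : Pt) : slicePoint l (z l) (z m) = z := by
  ext i
  have hi : i = l ∨ i = m := by omega
  rcases hi with rfl | rfl
  · rw [slicePoint_same]
  · rw [slicePoint_of_ne h]

theorem continuous_slicePoint (l : Fin 2) (y : ℝ) : Continuous fun s => slicePoint l s y := by
  unfold slicePoint
  refine (PiLp.continuous_toLp 2 _).comp (continuous_pi fun i => ?_)
  split_ifs <;> fun_prop

theorem measurePreserving_slicePoint (l : Fin 2) :
    MeasurePreserving (fun p : ℝ × ℝ => slicePoint l p.1 p.2) := by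
  have h1 := (PiLp.volume_preserving_toLp (Fin 2)).comp
    (volume_preserving_finTwoArrow ℝ).symm
  have h2 : MeasurePreserving (Prod.swap : ℝ × ℝ → ℝ × ℝ) := Measure.measurePreserving_swap
  fin_cases l
  · refine (congrArg (fun φ : ℝ × ℝ → Pt => MeasurePreserving φ) ?_).mpr h1
    funext p
    ext i
    fin_cases i <;> simp [slicePoint, MeasurableEquiv.finTwoArrow]
  · refine (congrArg (fun φ : ℝ × ℝ → Pt => MeasurePreserving φ) ?_).mpr (h1.comp h2)
    funext p
    ext i
    fin_cases i <;> simp [slicePoint, MeasurableEquiv.finTwoArrow]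

theorem integral_slicePoint (l : Fin 2) {φ : Pt → ℝ} (hφ : Integrable φ) :
    ∫ x, φ x = ∫ y, ∫ s, φ (slicePoint l s y) := by
  have hmp := measurePreserving_slicePoint l
  have hint : Integrable (fun p : ℝ × ℝ => φ (slicePoint l p.1 p.2)) (volume.prod volume) :=
    hmp.integrable_comp_of_integrable hφ
  rw [← integral_prod_symm (fun p : ℝ × ℝ => φ (slicePoint l p.1 p.2)) hint,
    ← hmp.map_eq, integral_map hmp.measurable.aemeasurable]
  · rfl
  · rw [hmp.map_eq]
    exact hφ.aestronglyMeasurable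

namespace Edge

theorem normal_eq_zero_iff (e : Edge) {l m : Fin 2} (h : m ≠ l) :
    e.normal l = 0 ↔ e.b m - e.a m = 0 := by
  have := e.length_pos.ne'
  have hlm : (l = 0 ∧ m = 1) ∨ (l = 1 ∧ m = 0) := by omega
  rcases hlm with ⟨rfl, rfl⟩ | ⟨rfl, rfl⟩
  · rw [normal_zero, div_eq_zero_iff, neg_eq_zero]; simp [this]
  · rw [normal_one, div_eq_zero_iff]; simp [this]

/-- The Jacobian relating arc length on the edge to the coordinate `m` transversal to the slices. -/
theorem length_mul_abs_normal (e : Edge) {l m : Fin 2} (h : m ≠ l) :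
    e.length * |e.normal l| = |e.b m - e.a m| := by
  have := e.length_pos
  have hlm : (l = 0 ∧ m = 1) ∨ (l = 1 ∧ m = 0) := by omega
  rcases hlm with ⟨rfl, rfl⟩ | ⟨rfl, rfl⟩
  · rw [normal_zero, abs_div, abs_neg, abs_of_pos this]; field_simp
  · rw [normal_one, abs_div, abs_of_pos this]; field_simp

theorem height_slicePoint_sub (e : Edge) (l : Fin 2) (s s' y : ℝ) :
    e.height (slicePoint l s y) = e.height (slicePoint l s' y) + e.normal l * (s - s') := by
  unfold height slicePoint
  fin_cases l
  · simp; ring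
  · simp; ring

/-- The parameter of the point of the edge whose `m`-th coordinate is `y`. -/
def crossTime (e : Edge) (m : Fin 2) (y : ℝ) : ℝ := (y - e.a m) / (e.b m - e.a m)

/-- The range of the `m`-th coordinate on the edge. -/
def crossRange (e : Edge) (m : Fin 2) : Set ℝ := Ioo (min (e.a m) (e.b m)) (max (e.a m) (e.b m))

theorem measurableSet_crossRange (e : Edge) (m : Fin 2) : MeasurableSet (e.crossRange m) :=
  measurableSet_Ioo

theorem mem_crossRange_iff (e : Edge) (m : Fin 2) {y : ℝ} :
    y ∈ e.crossRange m ↔ e.b m - e.a m ≠ 0 ∧ e.crossTime m y ∈ Ioo (0 : ℝ) 1 := by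
  unfold crossRange crossTime
  rcases lt_trichotomy (e.a m) (e.b m) with h | h | h
  · have h' : 0 < e.b m - e.a m := sub_pos.2 h
    rw [min_eq_left h.le, max_eq_right h.le, mem_Ioo, mem_Ioo, lt_div_iff₀ h', div_lt_iff₀ h']
    constructor
    · rintro ⟨h1, h2⟩
      exact ⟨h'.ne', by linarith, by linarith⟩
    · rintro ⟨-, h1, h2⟩
      exact ⟨by linarith, by linarith⟩
  · simp [h]
  · have h' : e.b m - e.a m < 0 := sub_neg.2 h
    rw [min_eq_right h.le, max_eq_left h.le, mem_Ioo, mem_Ioo, lt_div_iff_of_neg h',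
      div_lt_iff_of_neg h']
    constructor
    · rintro ⟨h1, h2⟩
      exact ⟨h'.ne, by linarith, by linarith⟩
    · rintro ⟨-, h1, h2⟩
      exact ⟨by linarith, by linarith⟩

theorem point_crossTime (e : Edge) {l m : Fin 2} (hm : m ≠ l) {y : ℝ}
    (hy : e.b m - e.a m ≠ 0) :
    e.point (e.crossTime m y) = slicePoint l (e.point (e.crossTime m y) l) y := by
  have h1 : e.point (e.crossTime m y) m = y := by
    rw [point_apply, crossTime]
    field_simp
    ring
  conv_lhs => rw [← slicePoint_eq hm (e.point (e.crossTime m y)), h1]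

theorem point_crossTime_mem (e : Edge) {m : Fin 2} {y : ℝ} (hy : y ∈ e.crossRange m) :
    e.point (e.crossTime m y) ∈ e.relInterior := by
  rw [relInterior_eq_image]
  exact mem_image_of_mem _ ((e.mem_crossRange_iff m).1 hy).2

/-- A line parallel to a coordinate axis that avoids the endpoints of an edge meets the edge only
transversally. -/
theorem mem_crossRange_of_mem (e : Edge) {l m : Fin 2} (hm : m ≠ l) {s y : ℝ}
    (ha : y ≠ e.a m) (hb : y ≠ e.b m) (h : slicePoint l s y ∈ e.carrier) :
    y ∈ e.crossRange m ∧ e.point (e.crossTime m y) = slicePoint l s y := by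
  rw [carrier_eq_image] at h
  obtain ⟨t, ht, hty⟩ := h
  have h1 : e.a m + t * (e.b m - e.a m) = y := by
    rw [← point_apply, hty, slicePoint_of_ne hm]
  have h2 : e.b m - e.a m ≠ 0 := by
    intro h0
    rw [h0] at h1
    exact ha (by linarith)
  have h3 : e.crossTime m y = t := by
    rw [crossTime, ← h1]
    field_simp
    ring
  refine ⟨(e.mem_crossRange_iff m).2 ⟨h2, ?_⟩, by rw [h3, hty]⟩
  rw [h3]
  refine ⟨ht.1.lt_of_ne fun h0 => ha ?_, ht.2.lt_of_ne fun h0 => hb ?_⟩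
  · rw [← h1, ← h0]; ring
  · rw [← h1, h0]; ring

/-- Slicing gives each crossing only a sign; the substitution of the coordinate `y` for arc length
supplies the factor `|ν|`, and sign times modulus is the normal component `ν`. An edge parallel to
the slices has empty range and `ν = 0`. -/
theorem setIntegral_crossRange (e : Edge) {l m : Fin 2} (hm : m ≠ l) (φ : Pt → ℝ) {ν : ℝ}
    (hν : |ν| = |e.normal l|) :
    ∫ y in e.crossRange m, Real.sign ν * φ (e.point (e.crossTime m y)) =
      e.integral fun t => φ (e.point t) * ν := by
  have hkey : ∫ y in e.crossRange m, φ (e.point (e.crossTime m y)) =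
      |e.b m - e.a m| * ∫ t in (0 : ℝ)..1, φ (e.point t) := by
    by_cases h0 : e.b m - e.a m = 0
    · have : e.crossRange m = ∅ := by
        ext y
        simp [mem_crossRange_iff, h0]
      rw [this, h0]; simp
    · have h1 := intervalIntegral.integral_comp_mul_add (a := 0) (b := 1)
        (fun y => φ (e.point (e.crossTime m y))) h0 (e.a m)
      have h2 : ∀ t, e.crossTime m ((e.b m - e.a m) * t + e.a m) = t := fun t => by
        unfold crossTime
        field_simp
        ring
      simp only [h2, mul_zero, zero_add, mul_one, sub_add_cancel, smul_eq_mul] at h1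
      rw [h1]
      unfold crossRange
      rcases lt_or_gt_of_ne h0 with h | h
      · have h' : e.b m < e.a m := sub_neg.1 h
        rw [min_eq_right h'.le, max_eq_left h'.le, intervalIntegral.integral_symm,
          intervalIntegral.integral_of_le h'.le, integral_Ioc_eq_integral_Ioo, abs_of_neg h]
        field_simp
      · have h' : e.a m < e.b m := sub_pos.1 h
        rw [min_eq_left h'.le, max_eq_right h'.le, intervalIntegral.integral_of_le h'.le,
          integral_Ioc_eq_integral_Ioo, abs_of_pos h]
        field_simp
  have hsign : Real.sign ν * |ν| = ν := by
    rcases lt_trichotomy ν 0 with h | rfl | h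
    · rw [Real.sign_of_neg h, abs_of_neg h]; ring
    · simp
    · rw [Real.sign_of_pos h, abs_of_pos h]; ring
  rw [integral_const_mul, hkey, integral, intervalIntegral.integral_mul_const,
    ← e.length_mul_abs_normal hm, ← hν]
  linear_combination (e.length * ∫ t in (0 : ℝ)..1, φ (e.point t)) * hsign

end Edge

/-! ## The divergence theorem on polygons -/

theorem hasDerivAt_peval_slicePoint (l : Fin 2) (y : ℝ) (p : MvPolynomial (Fin 2) ℝ) (s : ℝ) :
    HasDerivAt (fun s => peval (slicePoint l s y) p)
      (peval (slicePoint l s y) (MvPolynomial.pderiv l p)) s := by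
  have hX : ∀ i, HasDerivAt (fun s => slicePoint l s y i) (if i = l then 1 else 0) s := by
    intro i
    by_cases h : i = l
    · subst h
      simp only [slicePoint_same, if_true]
      exact hasDerivAt_id' s
    · simp only [slicePoint_of_ne h, if_neg h]
      exact hasDerivAt_const s y
  induction p using MvPolynomial.induction_on with
  | C c => simpa [peval] using hasDerivAt_const s c
  | add p p' hp hp' =>
    simp only [peval, map_add] at hp hp' ⊢
    exact hp.fun_add hp'
  | mul_X p i hp =>
    simp only [peval, map_mul, MvPolynomial.eval_X, Derivation.leibniz, smul_eq_mul, map_add,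
      MvPolynomial.pderiv_X] at hp ⊢
    refine (hp.fun_mul (hX i)).congr_deriv ?_
    by_cases h : i = l
    · subst h; simp; ring
    · simp [h, mul_comm]

section Family

variable {κ : Type*} {edge : κ → Edge} {S : Set Pt}

/-- Along a slice the height over the edge grows at the rate `normal l`, so the side of the edge
becomes the side of the crossing point. -/
theorem IsPolygon.slice_side [Finite κ] (hE : EdgesMeetInEndpoints edge) (hS : IsPolygon edge S)
    {j : κ} (hj : (edge j).carrier ⊆ frontier S) (l : Fin 2) {s y : ℝ}
    (hz : slicePoint l s y ∈ (edge j).relInterior) :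
    ∀ᶠ t in 𝓝 s, ((edge j).side S * (edge j).normal l * (t - s) < 0 → slicePoint l t y ∈ S) ∧
      (0 < (edge j).side S * (edge j).normal l * (t - s) → slicePoint l t y ∉ S) := by
  have h1 := (continuous_slicePoint l y).continuousAt.eventually (hS.eventually_side hE hj hz)
  filter_upwards [h1] with t ht
  rw [(edge j).height_slicePoint_sub l t s y, height_eq_zero_of_mem_relInterior hz, zero_add,
    ← mul_assoc] at ht
  exact ht

theorem eventually_mem_iff_of_notMem_frontier {X : Type*} [TopologicalSpace X] {U : Set X} (hU : IsOpen U)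
    {x : X} (hx : x ∉ frontier U) : ∀ᶠ y in 𝓝 x, (y ∈ U ↔ x ∈ U) := by
  by_cases hxU : x ∈ U
  · filter_upwards [hU.mem_nhds hxU] with y hy
    exact iff_of_true hy hxU
  · have hxc : x ∉ closure U := by
      rw [closure_eq_self_union_frontier]
      exact fun h => h.elim hxU hx
    filter_upwards [isClosed_closure.isOpen_compl.mem_nhds hxc] with y hy
    exact iff_of_false (fun h => hy (subset_closure h)) hxU

-- A slice that avoids all vertices meets the boundary of `S` only in transversal crossings of
-- edges, and no two edges are crossed at the same point. The fundamental theorem on the slice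
-- applies, with sign `1` where the outward normal points in the direction of increasing `s`.
open Classical in
theorem IsPolygon.integral_slice [Fintype κ] (hE : EdgesMeetInEndpoints edge)
    (hS : IsPolygon edge S) {l m : Fin 2} (hm : m ≠ l) {y : ℝ}
    (hy : ∀ j, y ≠ (edge j).a m ∧ y ≠ (edge j).b m) (p : MvPolynomial (Fin 2) ℝ) :
    ∫ s in {s | slicePoint l s y ∈ S}, peval (slicePoint l s y) (MvPolynomial.pderiv l p) =
      ∑ j : {j // (edge j).carrier ⊆ frontier S}, ((edge j).crossRange m).indicator (fun y =>
        Real.sign ((edge j).side S * (edge j).normal l) *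
          peval ((edge j).point ((edge j).crossTime m y)) p) y := by
  have hcross : ∀ j, y ∈ (edge j).crossRange m →
      (edge j).point ((edge j).crossTime m y) =
        slicePoint l ((edge j).point ((edge j).crossTime m y) l) y := fun j hj =>
    (edge j).point_crossTime hm (((edge j).mem_crossRange_iff m).1 hj).1
  have hmem : ∀ j, y ∈ (edge j).crossRange m →
      slicePoint l ((edge j).point ((edge j).crossTime m y) l) y ∈ (edge j).relInterior :=
    fun j hj => by
      rw [← hcross j hj]
      exact (edge j).point_crossTime_mem hj
  have hcont := continuous_slicePoint l y
  have hmain := setIntegral_deriv_eq_sum (U := {s | slicePoint l s y ∈ S})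
    (F := fun s => peval (slicePoint l s y) p)
    (F' := fun s => peval (slicePoint l s y) (MvPolynomial.pderiv l p))
    (Finset.univ.filter fun j : {j // (edge j).carrier ⊆ frontier S} =>
      y ∈ (edge j).crossRange m)
    (p := fun j => (edge j).point ((edge j).crossTime m y) l)
    (σ := fun j => Real.sign ((edge j).side S * (edge j).normal l))
    (by
      intro i hi j hj hij
      simp only [Finset.coe_filter, Finset.mem_univ, true_and, mem_ofPred_eq] at hi hj
      have h1 := hmem i hi
      simp only at hij
      rw [hij] at h1
      exact Subtype.ext (hE.eq_of_mem h1 ((edge j).relInterior_subset_carrier (hmem j hj))))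
    (hS.isOpen.preimage hcont)
    (by
      obtain ⟨R, hR⟩ := hS.isBounded.subset_closedBall 0
      refine (Metric.isBounded_closedBall (x := (0 : ℝ)) (r := R)).subset fun s hs => ?_
      have h1 := hR hs
      rw [mem_closedBall_zero_iff] at h1 ⊢
      have h2 := PiLp.norm_apply_le (slicePoint l s y) l
      rw [slicePoint_same] at h2
      exact h2.trans h1)
    (by
      intro x hx
      refine hcont.continuousAt.eventually (eventually_mem_iff_of_notMem_frontier hS.isOpen fun hf => ?_)
      obtain ⟨j, hj, hzj⟩ := hS.exists_edge hf
      obtain ⟨h1, h2⟩ := (edge j).mem_crossRange_of_mem hm (hy j).1 (hy j).2 hzj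
      refine hx ⟨j, hj⟩ (by simpa using h1) ?_
      simp only [h2, slicePoint_same])
    (by
      intro j hj
      have hj' : y ∈ (edge j).crossRange m := by simpa using hj
      have hside := hS.slice_side hE j.2 l (hmem j hj')
      have hne : (edge j).side S * (edge j).normal l ≠ 0 :=
        mul_ne_zero ((edge j).side_ne_zero S) fun h0 =>
          (((edge j).mem_crossRange_iff m).1 hj').1 (((edge j).normal_eq_zero_iff hm).1 h0)
      rcases lt_or_gt_of_ne hne with h | h
      · refine Or.inr ⟨Real.sign_of_neg h, hside.mono fun t ht => ⟨fun hlt => ?_, fun hlt => ?_⟩⟩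
        · exact ht.2 (mul_pos_of_neg_of_neg h (sub_neg.2 hlt))
        · exact ht.1 (mul_neg_of_neg_of_pos h (sub_pos.2 hlt))
      · refine Or.inl ⟨Real.sign_of_pos h, hside.mono fun t ht => ⟨fun hlt => ?_, fun hlt => ?_⟩⟩
        · exact ht.1 (mul_neg_of_pos_of_neg h (sub_neg.2 hlt))
        · exact ht.2 (mul_pos h (sub_pos.2 hlt)))
    (fun x => hasDerivAt_peval_slicePoint l y p x) ((continuous_peval _).comp hcont)
  rw [hmain, Finset.sum_filter]
  refine Finset.sum_congr rfl fun j _ => ?_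
  by_cases hj : y ∈ (edge j).crossRange m
  · rw [if_pos hj, indicator_of_mem hj, ← hcross j hj]
  · rw [if_neg hj, indicator_of_notMem hj]

open Classical in
/-- The divergence theorem on a polygon, for one component of a polynomial vector field. -/
theorem IsPolygon.integral_pderiv [Fintype κ] (hE : EdgesMeetInEndpoints edge)
    (hS : IsPolygon edge S) (l : Fin 2) (p : MvPolynomial (Fin 2) ℝ) :
    ∫ x in S, peval x (MvPolynomial.pderiv l p) =
      ∑ j : {j // (edge j).carrier ⊆ frontier S}, (edge j).integral fun t =>
        peval ((edge j).point t) p * (edge j).outwardNormal S l := by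
  obtain ⟨m, hm⟩ : ∃ m : Fin 2, m ≠ l := exists_ne l
  have hint : Integrable (S.indicator fun x => peval x (MvPolynomial.pderiv l p)) :=
    (integrable_indicator_iff hS.isOpen.measurableSet).2
      (integrableOn_of_continuous hS.isBounded (continuous_peval _))
  rw [← integral_indicator hS.isOpen.measurableSet, integral_slicePoint l hint]
  -- The slices through vertices form a null set.
  have hfin : (⋃ j, {(edge j).a m, (edge j).b m} : Set ℝ).Countable :=
    countable_iUnion fun j => (Set.toFinite _).countable
  have hae : ∀ᵐ y : ℝ, ∫ s, S.indicator (fun x => peval x (MvPolynomial.pderiv l p))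
      (slicePoint l s y) =
      ∑ j : {j // (edge j).carrier ⊆ frontier S}, ((edge j).crossRange m).indicator (fun y =>
        Real.sign ((edge j).side S * (edge j).normal l) *
          peval ((edge j).point ((edge j).crossTime m y)) p) y := by
    filter_upwards [hfin.ae_notMem volume] with y hy
    have hy' : ∀ j, y ≠ (edge j).a m ∧ y ≠ (edge j).b m := by
      intro j
      constructor <;> intro h <;> exact hy (mem_iUnion.2 ⟨j, by simp [h]⟩)
    have hms : MeasurableSet {s | slicePoint l s y ∈ S} :=
      (hS.isOpen.preimage (continuous_slicePoint l y)).measurableSet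
    rw [← hS.integral_slice hE hm hy' p, ← integral_indicator hms]
    rfl
  rw [integral_congr_ae hae, integral_finsetSum]
  · refine Finset.sum_congr rfl fun j _ => ?_
    rw [integral_indicator ((edge j).measurableSet_crossRange m), (edge j).setIntegral_crossRange hm (peval · p)]
    · simp only [Edge.outwardNormal_apply]
    · rw [abs_mul]
      rcases (edge j).side_eq S with h | h <;> rw [h] <;> simp
  · intro j _
    refine (integrable_indicator_iff ((edge j).measurableSet_crossRange m)).2 ?_
    have hc : Continuous fun y => Real.sign ((edge j).side S * (edge j).normal l) *
        peval ((edge j).point ((edge j).crossTime m y)) p := by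
      refine continuous_const.mul ((continuous_peval p).comp
        ((edge j).continuous_point.comp ?_))
      unfold Edge.crossTime
      fun_prop
    exact hc.integrableOn_Icc.mono_set Ioo_subset_Icc_self

end Family

/-- A piecewise constant function on a mesh that does not jump across interior edges and vanishes
at boundary edges is zero. -/
theorem PolygonalMesh.eq_zero_of_no_jump {Ω : Set Pt} {ι κ : Type*} [Fintype ι] [Finite κ]
    (M : PolygonalMesh Ω ι κ) (c : ι → ℝ) (d : κ → ℝ)
    (hc : ∀ i j, (M.edge j).carrier ⊆ frontier (M.cell i) → c i = d j)
    (hd : ∀ j, (M.edge j).carrier ⊆ frontier Ω → d j = 0) (i : ι) : c i = 0 := by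
  obtain ⟨x, hx⟩ := (M.polygon i).isConnected.nonempty
  have hm : (1 : Fin 2) ≠ 0 := by decide
  have hslice : Continuous fun y => slicePoint 0 (x 0) y := by
    unfold slicePoint
    refine (PiLp.continuous_toLp 2 _).comp (continuous_pi fun i => ?_)
    split_ifs <;> fun_prop
  have hfin : (⋃ j, {(M.edge j).a 1, (M.edge j).b 1} : Set ℝ).Countable :=
    countable_iUnion fun j => (Set.toFinite _).countable
  -- A line parallel to the first axis that passes through the element `i` and avoids all vertices:
  -- an open set of ordinates meets the complement of a countable set.
  obtain ⟨y, hyi, hy⟩ : ∃ y, slicePoint 0 (x 0) y ∈ M.cell i ∧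
      y ∉ (⋃ j, {(M.edge j).a 1, (M.edge j).b 1} : Set ℝ) := by
    have hopen := (M.polygon i).isOpen.preimage hslice
    have hne : x 1 ∈ (fun y => slicePoint 0 (x 0) y) ⁻¹' M.cell i := by
      rw [mem_preimage, slicePoint_eq hm]
      exact hx
    exact (hfin.dense_compl ℝ).inter_open_nonempty _ hopen ⟨_, hne⟩
  have hy' : ∀ j, y ≠ (M.edge j).a 1 ∧ y ≠ (M.edge j).b 1 := by
    intro j
    constructor <;> intro h <;> exact hy (mem_iUnion.2 ⟨j, by simp [h]⟩)
  have hcont := continuous_slicePoint 0 y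
  -- The piecewise constant function along this line. It does not jump at crossings, so it has one
  -- value off a discrete exceptional set; that value is zero beyond the bounded domain and `c i` in
  -- the element.
  set D : ℝ → ℝ := fun s => ∑ i, (M.cell i).indicator (fun _ => c i) (slicePoint 0 s y) with hD
  have hoff : ∀ s, (∀ j, slicePoint 0 s y ∉ (M.edge j).carrier) → ∀ᶠ t in 𝓝 s, D t = D s := by
    intro s hs
    have h1 : ∀ᶠ t in 𝓝 s, ∀ i, (slicePoint 0 t y ∈ M.cell i ↔ slicePoint 0 s y ∈ M.cell i) :=
      eventually_all.2 fun i => hcont.continuousAt.eventually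
        (eventually_mem_iff_of_notMem_frontier (M.polygon i).isOpen fun hf => by
          obtain ⟨j, -, hj⟩ := (M.polygon i).exists_edge hf
          exact hs j hj)
    filter_upwards [h1] with t ht
    refine Finset.sum_congr rfl fun i _ => ?_
    by_cases hi : slicePoint 0 s y ∈ M.cell i
    · rw [indicator_of_mem hi, indicator_of_mem ((ht i).2 hi)]
    · rw [indicator_of_notMem hi, indicator_of_notMem (fun h => hi ((ht i).1 h))]
  obtain ⟨a, ha⟩ := exists_eventually_eq_of_punctured D (by
    intro s
    by_cases hs : ∀ j, slicePoint 0 s y ∉ (M.edge j).carrier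
    · exact ⟨_, (hoff s hs).filter_mono nhdsWithin_le_nhds⟩
    push Not at hs
    obtain ⟨j, hj⟩ := hs
    obtain ⟨h1, h2⟩ := (M.edge j).mem_crossRange_of_mem hm (hy' j).1 (hy' j).2 hj
    have hz := (M.edge j).point_crossTime_mem h1
    rw [h2] at hz
    refine ⟨d j, ?_⟩
    have h3 := hcont.continuousAt.eventually
      (PolygonalMesh.eventually_sum_indicator_eq hz c (d j) (fun i hi => hc i j hi) (hd j))
    rw [eventually_nhdsWithin_iff]
    filter_upwards [h3] with t ht hts
    refine ht ?_
    rw [(M.edge j).height_slicePoint_sub 0 t s y, height_eq_zero_of_mem_relInterior hz, zero_add]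
    refine mul_ne_zero (fun h0 => ?_) (sub_ne_zero.2 hts)
    exact (((M.edge j).mem_crossRange_iff 1).1 h1).1 (((M.edge j).normal_eq_zero_iff hm).1 h0))
  have ha0 : a = 0 := by
    obtain ⟨R, hR⟩ := M.domain.isBounded.subset_closedBall 0
    have h1 : ∀ s, R < s → D s = 0 := by
      intro s hs
      refine Finset.sum_eq_zero fun i _ => indicator_of_notMem (fun h => ?_) _
      have h2 := hR (M.cell_subset i h)
      rw [mem_closedBall_zero_iff] at h2
      have h3 := PiLp.norm_apply_le (slicePoint 0 s y) 0
      rw [slicePoint_same, Real.norm_eq_abs] at h3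
      linarith [le_abs_self s]
    have h2 : ∀ᶠ t in 𝓝[≠] (R + 1), R < t :=
      (lt_mem_nhds (lt_add_one R)).filter_mono nhdsWithin_le_nhds
    obtain ⟨t, ht, ht'⟩ := ((ha (R + 1)).and h2).exists
    rw [← ht, h1 t ht']
  have hmem : ∀ᶠ t in 𝓝[≠] (x 0), slicePoint 0 t y ∈ M.cell i :=
    (hcont.continuousAt.eventually ((M.polygon i).isOpen.mem_nhds hyi)).filter_mono
      nhdsWithin_le_nhds
  obtain ⟨t, ht, ht'⟩ := ((ha (x 0)).and hmem).exists
  rw [← ha0, ← ht, hD]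
  exact (PolygonalMesh.sum_indicator_eq M c ht').symm

/-! ## Polynomials adapted to an edge -/

theorem peval_mul (x : Pt) (p p' : MvPolynomial (Fin 2) ℝ) :
    peval x (p * p') = peval x p * peval x p' := by simp [peval]

theorem peval_prod {κ : Type*} (x : Pt) (J : Finset κ) (p : κ → MvPolynomial (Fin 2) ℝ) :
    peval x (∏ j ∈ J, p j) = ∏ j ∈ J, peval x (p j) := by simp [peval]

theorem totalDegree_affine_le (a b c d : ℝ) :
    (MvPolynomial.C a * (MvPolynomial.X 0 - MvPolynomial.C b) +
      MvPolynomial.C c * (MvPolynomial.X 1 - MvPolynomial.C d) :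
        MvPolynomial (Fin 2) ℝ).totalDegree ≤ 1 := by
  refine (MvPolynomial.totalDegree_add _ _).trans (max_le ?_ ?_) <;>
  · refine (MvPolynomial.totalDegree_mul _ _).trans ?_
    rw [MvPolynomial.totalDegree_C, zero_add]
    refine (MvPolynomial.totalDegree_sub_C_le _ _).trans ?_
    rw [MvPolynomial.totalDegree_X]

theorem totalDegree_polynomial_aeval_le (p : Polynomial ℝ) {τ : MvPolynomial (Fin 2) ℝ}
    (hτ : τ.totalDegree ≤ 1) : (Polynomial.aeval τ p).totalDegree ≤ p.natDegree := by
  rw [Polynomial.aeval_eq_sum_range]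
  refine MvPolynomial.totalDegree_finsetSum_le fun n hn => ?_
  refine (MvPolynomial.totalDegree_smul_le _ _).trans
    ((MvPolynomial.totalDegree_pow _ _).trans ?_)
  have := Finset.mem_range.1 hn
  nlinarith

theorem peval_polynomial_aeval (x : Pt) (p : Polynomial ℝ) (τ : MvPolynomial (Fin 2) ℝ) :
    peval x (Polynomial.aeval τ p) = p.eval (peval x τ) := by
  induction p using Polynomial.induction_on' with
  | add p p' hp hp' => simp only [peval, map_add, Polynomial.eval_add] at *; rw [hp, hp']
  | monomial n a => simp [peval, Polynomial.aeval_monomial, MvPolynomial.algebraMap_eq]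

/-- Differentiation multiplies the coefficient of a monomial containing the variable by a positive
integer, which is invertible in characteristic zero. -/
theorem eq_C_of_pderiv_eq_zero {p : MvPolynomial (Fin 2) ℝ}
    (h : ∀ l, MvPolynomial.pderiv l p = 0) : ∃ c, p = MvPolynomial.C c := by
  refine ⟨MvPolynomial.coeff 0 p, ?_⟩
  ext n
  rw [MvPolynomial.coeff_C]
  split_ifs with hn
  · rw [hn]
  · obtain ⟨l, hl⟩ : ∃ l, n l ≠ 0 := by
      by_contra! hcon
      exact hn (Finsupp.ext fun l => (hcon l).symm)
    have h1 := MvPolynomial.coeff_pderiv (i := l) p (n - Finsupp.single l 1)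
    rw [h l, MvPolynomial.coeff_zero, tsub_add_cancel_of_le
      (by rw [Finsupp.single_le_iff]; omega)] at h1
    refine (mul_eq_zero.1 h1.symm).resolve_right ?_
    positivity

theorem totalDegree_pderiv_le {p : MvPolynomial (Fin 2) ℝ} {k : ℕ} (hp : p.totalDegree ≤ k)
    (l : Fin 2) : (MvPolynomial.pderiv l p).totalDegree ≤ k - 1 := by
  refine Finset.sup_le fun n hn => ?_
  rw [MvPolynomial.mem_support_iff, MvPolynomial.coeff_pderiv] at hn
  have h1 := MvPolynomial.le_totalDegree (MvPolynomial.mem_support_iff.2 (left_ne_zero_of_mul hn))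
  rw [Finsupp.sum_fintype _ _ (fun _ => rfl), Fin.sum_univ_two] at h1 ⊢
  fin_cases l <;> simp at h1 <;> omega

theorem integral_eval_nonneg {P : Polynomial ℝ} (hP : ∀ t ∈ Ioo (0 : ℝ) 1, 0 ≤ P.eval t) :
    0 ≤ ∫ t in (0 : ℝ)..1, P.eval t := by
  rw [intervalIntegral.integral_of_le zero_le_one, integral_Ioc_eq_integral_Ioo]
  exact setIntegral_nonneg measurableSet_Ioo hP

theorem eq_zero_of_integral_eval_eq_zero {P : Polynomial ℝ}
    (hP : ∀ t ∈ Ioo (0 : ℝ) 1, 0 ≤ P.eval t) (h : ∫ t in (0 : ℝ)..1, P.eval t = 0) : P = 0 := by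
  rw [intervalIntegral.integral_of_le zero_le_one, integral_Ioc_eq_integral_Ioo,
    setIntegral_eq_zero_iff_of_nonneg_ae
      ((ae_restrict_iff' measurableSet_Ioo).2 (Eventually.of_forall hP))
      (P.continuous.integrableOn_Icc.mono_set Ioo_subset_Icc_self)] at h
  have h1 := Measure.eqOn_open_of_ae_eq h isOpen_Ioo P.continuous.continuousOn continuousOn_const
  exact Polynomial.eq_zero_of_infinite_isRoot _
    ((Ioo_infinite (zero_lt_one (α := ℝ))).mono fun t ht => h1 ht)

namespace Edge

/-- The affine polynomial whose values are the signed distances from the line of the edge. -/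
def linePoly (e : Edge) : MvPolynomial (Fin 2) ℝ :=
  MvPolynomial.C (e.normal 0) * (MvPolynomial.X 0 - MvPolynomial.C (e.a 0)) +
    MvPolynomial.C (e.normal 1) * (MvPolynomial.X 1 - MvPolynomial.C (e.a 1))

theorem peval_linePoly (e : Edge) (y : Pt) : peval y e.linePoly = e.height y := by
  simp [linePoly, peval, height]

/-- The affine polynomial that inverts the parametrization of the edge. -/
def paramPoly (e : Edge) : MvPolynomial (Fin 2) ℝ :=
  MvPolynomial.C ((e.b 0 - e.a 0) / e.length ^ 2) *
      (MvPolynomial.X 0 - MvPolynomial.C (e.a 0)) +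
    MvPolynomial.C ((e.b 1 - e.a 1) / e.length ^ 2) *
      (MvPolynomial.X 1 - MvPolynomial.C (e.a 1))

theorem peval_paramPoly_point (e : Edge) (t : ℝ) : peval (e.point t) e.paramPoly = t := by
  have := e.length_pos.ne'
  simp only [paramPoly, peval, map_add, map_mul, map_sub, MvPolynomial.eval_C,
    MvPolynomial.eval_X, point_apply]
  field_simp
  linear_combination (-t) * e.length_sq

theorem point_peval_paramPoly (e : Edge) {y : Pt} (hy : e.height y = 0) :
    e.point (peval y e.paramPoly) = y := by
  obtain ⟨t, rfl⟩ := e.exists_point_eq_of_height_eq_zero hy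
  rw [peval_paramPoly_point]

theorem peval_paramPoly_comp_point (e f : Edge) (t : ℝ) :
    peval (f.point t) e.paramPoly = peval (f.point 0) e.paramPoly +
      t * (peval (f.point 1) e.paramPoly - peval (f.point 0) e.paramPoly) := by
  simp only [paramPoly, peval, map_add, map_mul, map_sub, MvPolynomial.eval_C,
    MvPolynomial.eval_X, point_apply]
  ring

theorem height_comp_point (e f : Edge) (t : ℝ) :
    e.height (f.point t) = e.height (f.point 0) +
      t * (e.height (f.point 1) - e.height (f.point 0)) := by
  simp only [height, point_apply]
  ring

/-- The restriction of a polynomial in two variables to the line of the edge. -/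
def restrict (e : Edge) : MvPolynomial (Fin 2) ℝ →ₐ[ℝ] Polynomial ℝ :=
  MvPolynomial.aeval fun l =>
    Polynomial.C (e.a l) + Polynomial.X * Polynomial.C (e.b l - e.a l)

theorem eval_restrict (e : Edge) (t : ℝ) (p : MvPolynomial (Fin 2) ℝ) :
    (e.restrict p).eval t = peval (e.point t) p := by
  induction p using MvPolynomial.induction_on with
  | C c => simp [restrict, peval, Polynomial.algebraMap_eq]
  | add p p' hp hp' => rw [map_add, Polynomial.eval_add, hp, hp']; simp [peval]
  | mul_X p i hp =>
    rw [map_mul, Polynomial.eval_mul, hp, peval_mul]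
    simp [restrict, peval, point_apply]

theorem height_point_eq_zero_of_ne (e f : Edge) {s s' : ℝ} (hs : s ≠ s')
    (h : e.height (f.point s) = 0) (h' : e.height (f.point s') = 0) (t : ℝ) :
    e.height (f.point t) = 0 := by
  rw [height_comp_point] at h h' ⊢
  have h1 : e.height (f.point 1) - e.height (f.point 0) = 0 := by
    have : (s - s') * (e.height (f.point 1) - e.height (f.point 0)) = 0 := by
      linear_combination h - h'
    exact (mul_eq_zero.1 this).resolve_left (sub_ne_zero.2 hs)
  rw [h1] at h ⊢
  linarith

theorem carrier_subset_line_iff (e f : Edge) :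
    f.carrier ⊆ e.line ↔ ∀ t, e.height (f.point t) = 0 := by
  rw [carrier_eq_image]
  constructor
  · intro h
    refine e.height_point_eq_zero_of_ne f zero_ne_one ?_ ?_
    · exact e.mem_line_iff.1 (h (mem_image_of_mem _ ⟨le_rfl, zero_le_one⟩))
    · exact e.mem_line_iff.1 (h (mem_image_of_mem _ ⟨zero_le_one, le_rfl⟩))
  · rintro h _ ⟨t, -, rfl⟩
    exact e.mem_line_iff.2 (h t)

/-- If the lines of `f` and `g` both contain the line of `e`, they coincide. -/
theorem carrier_subset_line_of_common {e f g : Edge} (hf : ∀ t, f.height (e.point t) = 0)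
    (hg : ∀ t, g.height (e.point t) = 0) : g.carrier ⊆ f.line := by
  rw [carrier_subset_line_iff]
  obtain ⟨s, hs⟩ := g.exists_point_eq_of_height_eq_zero (hg 0)
  obtain ⟨s', hs'⟩ := g.exists_point_eq_of_height_eq_zero (hg 1)
  have hne : s ≠ s' := by
    rintro rfl
    exact zero_ne_one (e.point_injective (hs.symm.trans hs'))
  exact f.height_point_eq_zero_of_ne g hne (by rw [hs, hf]) (by rw [hs', hf])

end Edge

section Family

variable {κ : Type*} {edge : κ → Edge} {S : Set Pt}

/-- The line through an edge of a convex polygon does not meet the polygon. -/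
theorem IsPolygon.height_ne_zero_of_convex (hS : IsPolygon edge S) (hc : Convex ℝ S) {j : κ}
    (hj : (edge j).carrier ⊆ frontier S) {y : Pt} (hy : y ∈ S) : (edge j).height y ≠ 0 := by
  intro h0
  obtain ⟨t, rfl⟩ := (edge j).exists_point_eq_of_height_eq_zero h0
  have hdisj : ∀ s ∈ Icc (0 : ℝ) 1, (edge j).point s ∉ S ∧ (edge j).point s ∈ closure S := by
    intro s hs
    have h1 : (edge j).point s ∈ frontier S := hj (by
      rw [Edge.carrier_eq_image]; exact mem_image_of_mem _ hs)
    rw [hS.isOpen.frontier_eq] at h1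
    exact ⟨h1.2, h1.1⟩
  have hcombo : ∀ α β s u : ℝ, α + β = 1 →
      α • (edge j).point s + β • (edge j).point u = (edge j).point (α * s + β * u) := by
    intro α β s u h
    obtain rfl : α = 1 - β := by linarith
    ext l
    simp only [PiLp.add_apply, PiLp.smul_apply, smul_eq_mul, Edge.point_apply]
    ring
  -- Open segments from a point of the open convex set `S` to a point of its closure stay in `S`. If
  -- the line met `S` beyond one end of the edge, the midpoint of the edge would lie between that
  -- point and the other end, hence in `S`; the weights below solve for this midpoint.
  have key : ∀ u ∈ Icc (0 : ℝ) 1, ∀ α : ℝ, 0 < α → α < 1 →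
      (edge j).point (α * t + (1 - α) * u) ∈ S := by
    intro u hu α h0 h1
    rw [← hcombo α (1 - α) t u (by ring)]
    have h2 := hc.combo_interior_closure_subset_interior (a := α) (b := 1 - α) h0 (by linarith)
      (by ring) (Set.add_mem_add (Set.smul_mem_smul_set (hS.isOpen.interior_eq.symm ▸ hy))
        (Set.smul_mem_smul_set (hdisj u hu).2))
    exact interior_subset h2
  have ht : t < 0 ∨ 1 < t := by
    by_contra! hcon
    exact (hdisj t hcon).1 hy
  rcases ht with ht | ht
  · refine (hdisj (2⁻¹) ⟨by norm_num, by norm_num⟩).1 ?_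
    have h1 : 0 < 1 - t := by linarith
    have h2 := key 1 ⟨zero_le_one, le_rfl⟩ (2⁻¹ / (1 - t)) (by positivity)
      ((div_lt_one h1).2 (by linarith))
    convert h2 using 2
    field_simp
    ring
  · refine (hdisj (2⁻¹) ⟨by norm_num, by norm_num⟩).1 ?_
    have h1 : 0 < t := by linarith
    have h2 := key 0 ⟨le_rfl, zero_le_one⟩ (2⁻¹ / t) (by positivity)
      ((div_lt_one h1).2 (by linarith))
    convert h2 using 2
    field_simp
    ring

open Classical in
/-- The number of times that the line of an edge has to be used in a bubble function: once for
convex polygons and twice for the others. -/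
def bubbleMultiplicity (S : Set Pt) : ℕ := if Convex ℝ S then 1 else 2

/-- A polynomial that is nonnegative on the polygon and vanishes exactly on the line of a given
edge. -/
theorem IsPolygon.exists_weight (hS : IsPolygon edge S) {j : κ}
    (hj : (edge j).carrier ⊆ frontier S) : ∃ b : MvPolynomial (Fin 2) ℝ,
      b.totalDegree ≤ bubbleMultiplicity S ∧ (∀ z, peval z b = 0 ↔ (edge j).height z = 0) ∧
        ∀ z ∈ closure S, 0 ≤ peval z b := by
  have hdeg : (edge j).linePoly.totalDegree ≤ 1 := totalDegree_affine_le _ _ _ _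
  unfold bubbleMultiplicity
  split_ifs with hc
  · have hcl : ∀ φ : Pt → ℝ, Continuous φ → (∀ z ∈ S, 0 < φ z) → ∀ z ∈ closure S, 0 ≤ φ z :=
      fun φ hφ h z hz => closure_minimal (fun z hz => (h z hz).le)
        (isClosed_le continuous_const hφ) hz
    rcases pos_or_neg_of_isPreconnected hS.isConnected.isPreconnected
      (edge j).continuous_height.continuousOn
      (fun y hy => hS.height_ne_zero_of_convex hc hj hy) with h | h
    · refine ⟨(edge j).linePoly, hdeg, fun z => by rw [Edge.peval_linePoly], fun z hz => ?_⟩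
      rw [Edge.peval_linePoly]
      exact hcl _ (edge j).continuous_height h z hz
    · have hneg : ∀ z, peval z (-(edge j).linePoly) = -(edge j).height z := fun z => by
        rw [← Edge.peval_linePoly]; simp [peval]
      refine ⟨-(edge j).linePoly, by rwa [MvPolynomial.totalDegree_neg], fun z => by
        rw [hneg, neg_eq_zero], fun z hz => ?_⟩
      rw [hneg]
      exact hcl (fun z => -(edge j).height z) (edge j).continuous_height.neg
        (fun z hz => neg_pos.2 (h z hz)) z hz
  · have hsq : ∀ z, peval z ((edge j).linePoly ^ 2) = (edge j).height z ^ 2 := fun z => by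
      rw [← Edge.peval_linePoly]; simp [peval]
    refine ⟨(edge j).linePoly ^ 2, (MvPolynomial.totalDegree_pow _ _).trans (by omega),
      fun z => by rw [hsq]; simp, fun z _ => by rw [hsq]; positivity⟩

end Family

/-! ## Weak functions with vanishing weak gradient -/

namespace PolygonalMesh

variable {Ω : Set Pt} {ι κ : Type*}

theorem gradDegree_eq (M : PolygonalMesh Ω ι κ) {k : ℕ} (i : ι) :
    M.gradDegree k i = bubbleMultiplicity (M.cell i) * Nat.card (M.EdgeOf i) + k - 1 := by
  unfold gradDegree bubbleMultiplicity
  split_ifs <;> simp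

theorem bubbleMultiplicity_pos (S : Set Pt) : 1 ≤ bubbleMultiplicity S := by
  unfold bubbleMultiplicity
  split_ifs <;> norm_num

variable [Fintype κ] (M : PolygonalMesh Ω ι κ) {k q r : ℕ}

theorem continuous_dotProduct_val {r : ℕ} (φ : VecPoly r) (e : Edge) (n : Fin 2 → ℝ) :
    Continuous fun t => φ.val (e.point t) ⬝ᵥ n := by
  simp only [VecPoly.val, dotProduct]
  exact continuous_finsetSum _ fun l _ =>
    ((continuous_peval _).comp e.continuous_point).mul continuous_const

open Classical in
/-- Integration by parts in the definition of the discrete weak gradient. -/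
theorem weakGradRhs_eq (i : ι) (v : M.LocalSpace k q i) (φ : VecPoly r) :
    M.weakGradRhs i v φ =
      (∫ x in M.cell i, ∑ l, peval x (MvPolynomial.pderiv l v.1.1) * peval x (φ l).1) +
        ∑ j : M.EdgeOf i, (M.edge j).integral fun t =>
          ((v.2 j).1.eval t - peval ((M.edge j).point t) v.1.1) *
            (φ.val ((M.edge j).point t) ⬝ᵥ fun l => (M.edge j).outwardNormal (M.cell i) l) := by
  have hb := (M.polygon i).isBounded
  have hdiv : ∀ l, ∫ x in M.cell i, peval x (MvPolynomial.pderiv l (v.1.1 * (φ l).1)) =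
      ∑ j : M.EdgeOf i, (M.edge j).integral fun t =>
        peval ((M.edge j).point t) (v.1.1 * (φ l).1) * (M.edge j).outwardNormal (M.cell i) l :=
    fun l => (M.polygon i).integral_pderiv M.edgesMeet l _
  have h1 : (∫ x in M.cell i, ∑ l, peval x (MvPolynomial.pderiv l v.1.1) * peval x (φ l).1) +
      ∫ x in M.cell i, peval x v.1.1 * peval x φ.div =
        ∑ l, ∫ x in M.cell i, peval x (MvPolynomial.pderiv l (v.1.1 * (φ l).1)) := by
    rw [← integral_add, ← integral_finsetSum]
    · congr 1; ext x
      simp [VecPoly.div, peval, Fin.sum_univ_two]; ring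
    · exact fun l _ => integrableOn_of_continuous hb (continuous_peval _)
    · exact integrableOn_of_continuous hb (continuous_finsetSum _ fun l _ =>
        (continuous_peval _).mul (continuous_peval _))
    · exact integrableOn_of_continuous hb ((continuous_peval _).mul (continuous_peval _))
  have h2 : ∑ l, ∫ x in M.cell i, peval x (MvPolynomial.pderiv l (v.1.1 * (φ l).1)) =
      ∑ j : M.EdgeOf i, (M.edge j).integral fun t => peval ((M.edge j).point t) v.1.1 *
        (φ.val ((M.edge j).point t) ⬝ᵥ fun l => (M.edge j).outwardNormal (M.cell i) l) := by
    rw [Finset.sum_congr rfl fun l _ => hdiv l, Finset.sum_comm]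
    refine Finset.sum_congr rfl fun j _ => ?_
    unfold Edge.integral
    rw [← Finset.mul_sum, ← intervalIntegral.integral_finsetSum]
    · simp only [VecPoly.val, dotProduct, peval_mul, Finset.mul_sum, mul_assoc]
    · exact fun l _ => (((continuous_peval _).comp (M.edge j).continuous_point).mul
        continuous_const).intervalIntegrable _ _
  have h3 : ∀ j : M.EdgeOf i, ((M.edge j).integral fun t =>
      ((v.2 j).1.eval t - peval ((M.edge j).point t) v.1.1) *
        (φ.val ((M.edge j).point t) ⬝ᵥ fun l => (M.edge j).outwardNormal (M.cell i) l)) =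
      ((M.edge j).integral fun t => (v.2 j).1.eval t *
        (φ.val ((M.edge j).point t) ⬝ᵥ fun l => (M.edge j).outwardNormal (M.cell i) l)) -
      (M.edge j).integral fun t => peval ((M.edge j).point t) v.1.1 *
        (φ.val ((M.edge j).point t) ⬝ᵥ fun l => (M.edge j).outwardNormal (M.cell i) l) := by
    intro j
    unfold Edge.integral
    rw [← mul_sub, ← intervalIntegral.integral_sub]
    · simp only [sub_mul]
    · exact ((v.2 j).1.continuous.mul (continuous_dotProduct_val _ _ _)).intervalIntegrable _ _
    · exact (((continuous_peval _).comp (M.edge j).continuous_point).mul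
        (continuous_dotProduct_val _ _ _)).intervalIntegrable _ _
  rw [Finset.sum_congr rfl fun j _ => h3 j, Finset.sum_sub_distrib]
  unfold weakGradRhs
  linarith

theorem weakGradRhs_eq_zero {i : ι} {v : M.LocalSpace k q i} (hv : M.weakGrad r i v = 0)
    (φ : VecPoly r) : M.weakGradRhs i v φ = 0 := by
  rw [← M.weakGrad_spec, hv]
  simp [VecPoly.val, peval, dotProduct]

/-- If the weak gradient vanishes, the interior component is constant. -/
theorem exists_eq_C_of_weakGrad_eq_zero {i : ι} (hr : M.gradDegree k i ≤ r)
    {v : M.LocalSpace k q i} (hv : M.weakGrad r i v = 0) : ∃ c, v.1.1 = MvPolynomial.C c := by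
  classical
  have hvdeg : v.1.1.totalDegree ≤ k := (MvPolynomial.mem_restrictTotalDegree _ _ _).1 v.1.2
  -- For `k = 0` nothing has to be shown, and the degree bound would be one too small for the bubble
  -- function `B`.
  rcases Nat.eq_zero_or_pos k with rfl | hk
  · exact ⟨_, MvPolynomial.totalDegree_eq_zero_iff_eq_C.1 (Nat.le_zero.1 hvdeg)⟩
  choose b hbdeg hb0 hbpos using fun j : M.EdgeOf i => (M.polygon i).exists_weight j.2
  set B : MvPolynomial (Fin 2) ℝ := ∏ j, b j with hB
  have hBdeg : B.totalDegree ≤ bubbleMultiplicity (M.cell i) * Nat.card (M.EdgeOf i) := by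
    refine (MvPolynomial.totalDegree_finsetProd _ _).trans ?_
    refine (Finset.sum_le_card_nsmul _ _ _ fun j _ => hbdeg j).trans ?_
    rw [smul_eq_mul, mul_comm, Finset.card_univ, Nat.card_eq_fintype_card]
  -- No weight is the zero polynomial, since it does not vanish at the point at unit height over an
  -- endpoint.
  have hBne : B ≠ 0 := by
    refine Finset.prod_ne_zero_iff.2 fun j _ h0 => ?_
    have h1 := (hb0 j ((M.edge j).a + (1 : ℝ) • (M.edge j).normal)).1 (by rw [h0]; simp [peval])
    rw [Edge.height_add_normal] at h1
    simp [Edge.height] at h1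
  have hdeg : ∀ l, B * MvPolynomial.pderiv l v.1.1 ∈ Poly r := by
    intro l
    rw [MvPolynomial.mem_restrictTotalDegree]
    refine (MvPolynomial.totalDegree_mul _ _).trans ?_
    have h1 := totalDegree_pderiv_le hvdeg l
    rw [gradDegree_eq] at hr
    omega
  -- `φ = B ∇v₀` vanishes on `∂T`, so only the integral of `B |∇v₀|²` is left. The degree is at most
  -- that of `B` plus `k - 1`.
  set φ : VecPoly r := fun l => ⟨B * MvPolynomial.pderiv l v.1.1, hdeg l⟩ with hφ
  have h0 := M.weakGradRhs_eq_zero hv φ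
  rw [weakGradRhs_eq, Finset.sum_eq_zero, add_zero] at h0
  swap
  · intro j _
    have h1 : ∀ t, φ.val ((M.edge j).point t) = 0 := by
      intro t
      funext l
      have hB0 : peval ((M.edge j).point t) B = 0 := by
        rw [hB, peval_prod]
        exact Finset.prod_eq_zero (Finset.mem_univ j) ((hb0 j _).2 (Edge.height_point _ _))
      simp only [VecPoly.val, hφ, peval_mul, hB0, zero_mul, Pi.zero_apply]
    simp [Edge.integral, h1]
  have hBpos : ∀ x ∈ M.cell i, 0 ≤ peval x B := fun x hx => by
    rw [hB, peval_prod]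
    exact Finset.prod_nonneg fun j _ => hbpos j x (subset_closure hx)
  have hform : ∀ x, ∑ l, peval x (MvPolynomial.pderiv l v.1.1) * peval x (φ l).1 =
      peval x B * ∑ l, peval x (MvPolynomial.pderiv l v.1.1) ^ 2 := fun x => by
    rw [Finset.mul_sum]
    refine Finset.sum_congr rfl fun l _ => ?_
    simp only [hφ, peval_mul]
    ring
  simp only [hform] at h0
  have hcont : Continuous fun x => peval x B * ∑ l, peval x (MvPolynomial.pderiv l v.1.1) ^ 2 :=
    (continuous_peval _).mul (continuous_finsetSum _ fun l _ => (continuous_peval _).pow 2)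
  rw [setIntegral_eq_zero_iff_of_nonneg_ae ((ae_restrict_iff'
    (M.polygon i).isOpen.measurableSet).2 (Eventually.of_forall fun x hx =>
      mul_nonneg (hBpos x hx) (Finset.sum_nonneg fun l _ => sq_nonneg _)))
    (integrableOn_of_continuous (M.polygon i).isBounded hcont)] at h0
  have h1 := Measure.eqOn_open_of_ae_eq h0 (M.polygon i).isOpen hcont.continuousOn
    continuousOn_const
  refine eq_C_of_pderiv_eq_zero fun l => ?_
  have h2 : B * MvPolynomial.pderiv l v.1.1 = 0 := by
    refine eq_zero_of_peval_eq_zero (M.polygon i).isOpen (M.polygon i).isConnected.nonempty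
      fun x hx => ?_
    rw [peval_mul]
    rcases mul_eq_zero.1 (h1 hx) with h | h
    · rw [h, zero_mul]
    · have h3 := (Finset.sum_eq_zero_iff_of_nonneg fun l _ => sq_nonneg _).1 h l
        (Finset.mem_univ l)
      rw [pow_eq_zero_iff two_ne_zero] at h3
      rw [h3, mul_zero]
  exact (mul_eq_zero.1 h2).resolve_left hBne

/-- If the weak gradient vanishes and the boundary component is constant on each edge, other than
`j₀`, on the straight line through the edge `j₀`, then it equals the interior component on `j₀`. -/
theorem eq_C_of_weakGrad_eq_zero {i : ι} (hqk : q ≤ k) (hr : M.gradDegree k i ≤ r)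
    {v : M.LocalSpace k q i} (hv : M.weakGrad r i v = 0) {c : ℝ}
    (hc : v.1.1 = MvPolynomial.C c) (j₀ : M.EdgeOf i)
    (hconst : ∀ j : M.EdgeOf i, j ≠ j₀ → (M.edge j).carrier ⊆ (M.edge j₀).line →
      ∃ d, (v.2 j).1 = Polynomial.C d) :
    (v.2 j₀).1 = Polynomial.C c := by
  classical
  choose b hbdeg hb0 hbpos using fun j : M.EdgeOf i => (M.polygon i).exists_weight j.2
  -- The edges on the line of `j₀`. They cannot be removed by a weight without losing `j₀` itself.
  set J : Finset (M.EdgeOf i) :=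
    Finset.univ.filter fun j => (M.edge j).carrier ⊆ (M.edge j₀).line with hJ
  have hmemJ : ∀ j, j ∈ J ↔ ∀ t, (M.edge j₀).height ((M.edge j).point t) = 0 := fun j => by
    rw [hJ, Finset.mem_filter, ← Edge.carrier_subset_line_iff]
    simp
  have hj₀ : j₀ ∈ J := (hmemJ j₀).2 (Edge.height_point _)
  set τ := (M.edge j₀).paramPoly with hτ
  set α : M.EdgeOf i → ℝ := fun j => peval ((M.edge j).point 0) τ with hα
  set β : M.EdgeOf i → ℝ := fun j => peval ((M.edge j).point 1) τ with hβ
  have hparam : ∀ (j : M.EdgeOf i) (t : ℝ),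
      peval ((M.edge j).point t) τ = α j + t * (β j - α j) := fun j t =>
    Edge.peval_paramPoly_comp_point _ _ t
  have hαβ : ∀ j ∈ J, α j ≠ β j := by
    intro j hj h
    have h1 := (M.edge j₀).point_peval_paramPoly ((hmemJ j).1 hj 0)
    have h2 := (M.edge j₀).point_peval_paramPoly ((hmemJ j).1 hj 1)
    refine zero_ne_one ((M.edge j).point_injective (h1.symm.trans (Eq.trans ?_ h2)))
    exact congrArg _ h
  -- The boundary term `(v_b - c) (n₀·n)` as a polynomial in `τ`, valid on the edges in `J`: on `j₀`
  -- the coordinate `τ` is the edge parameter, and on the others `v_b` is constant, equal to its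
  -- zeroth coefficient. So only `j₀` contributes to the sum of the degrees.
  set w : M.EdgeOf i → Polynomial ℝ := fun j =>
    (if j = j₀ then (v.2 j).1 - Polynomial.C c else Polynomial.C ((v.2 j).1.coeff 0 - c)) *
      Polynomial.C (∑ l, (M.edge j₀).normal l * (M.edge j).outwardNormal (M.cell i) l) with hw
  have hwdeg : ∑ j ∈ J, (w j).natDegree ≤ q := by
    rw [Finset.sum_eq_single_of_mem j₀ hj₀]
    · refine (Polynomial.natDegree_mul_C_le _ _).trans ?_
      rw [if_pos rfl, Polynomial.natDegree_sub_C]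
      exact Polynomial.natDegree_le_iff_degree_le.2 (Polynomial.mem_degreeLE.1 (v.2 j₀).2)
    · intro j _ hj
      rw [hw]
      simp only [if_neg hj, ← Polynomial.C_mul, Polynomial.natDegree_C]
  have htime : ∀ j ∈ J, ∀ t ∈ Ioo (min (α j) (β j)) (max (α j) (β j)),
      ∃ s ∈ Ioo (0 : ℝ) 1, t = α j + s * (β j - α j) := by
    intro j hj t ht
    have h0 : β j - α j ≠ 0 := sub_ne_zero.2 (hαβ j hj).symm
    refine ⟨(t - α j) / (β j - α j), ?_, by field_simp; ring⟩
    rcases lt_or_gt_of_ne (hαβ j hj) with h | h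
    · rw [min_eq_left h.le, max_eq_right h.le] at ht
      have h' : 0 < β j - α j := sub_pos.2 h
      rw [mem_Ioo, lt_div_iff₀ h', div_lt_iff₀ h']
      exact ⟨by linarith [ht.1], by linarith [ht.2]⟩
    · rw [min_eq_right h.le, max_eq_left h.le] at ht
      have h' : β j - α j < 0 := sub_neg.2 h
      rw [mem_Ioo, lt_div_iff_of_neg h', div_lt_iff_of_neg h']
      exact ⟨by linarith [ht.2], by linarith [ht.1]⟩
  -- The intervals are the images of the edges in `J` under `τ`. They are disjoint because `τ` is
  -- injective on the line and the edges have disjoint relative interiors.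
  obtain ⟨p, hp0, hpdeg, hpos⟩ := exists_mul_nonneg_on_intervals J
    (fun j => min (α j) (β j)) (fun j => max (α j) (β j))
    (fun j hj => min_lt_max.2 (hαβ j hj))
    (by
      intro j hj j' hj' hne
      rw [Set.disjoint_left]
      intro t ht ht'
      obtain ⟨s, hs, rfl⟩ := htime j hj t ht
      obtain ⟨s', hs', hss'⟩ := htime j' hj' _ ht'
      have h1 := (M.edge j₀).point_peval_paramPoly ((hmemJ j).1 hj s)
      have h2 := (M.edge j₀).point_peval_paramPoly ((hmemJ j').1 hj' s')
      rw [← hτ, hparam] at h1 h2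
      rw [hss', h2] at h1
      refine hne (Subtype.ext (M.edgesMeet.eq_of_mem (z := (M.edge j).point s) ?_ ?_))
      · rw [Edge.relInterior_eq_image]
        exact mem_image_of_mem _ hs
      · rw [← h1, Edge.carrier_eq_image]
        exact mem_image_of_mem _ (Ioo_subset_Icc_self hs')) w
  set B : MvPolynomial (Fin 2) ℝ := ∏ j ∈ Jᶜ, b j with hB
  -- With multiplicity `μ` of the weights, the degree is at most `μ |Jᶜ| + (|J| - 1) + q`, which is
  -- at most `μ N + k - 1` because `μ ≥ 1`, `q ≤ k` and `J` is nonempty.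
  have hdeg : ∀ l, MvPolynomial.C ((M.edge j₀).normal l) * (B * Polynomial.aeval τ p) ∈ Poly r := by
    intro l
    rw [MvPolynomial.mem_restrictTotalDegree]
    refine (MvPolynomial.totalDegree_mul _ _).trans ?_
    rw [MvPolynomial.totalDegree_C, zero_add]
    refine (MvPolynomial.totalDegree_mul _ _).trans ?_
    have h1 : (Polynomial.aeval τ p).totalDegree ≤ p.natDegree :=
      totalDegree_polynomial_aeval_le p (totalDegree_affine_le _ _ _ _)
    have h2 : B.totalDegree ≤ Jᶜ.card * bubbleMultiplicity (M.cell i) := by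
      refine (MvPolynomial.totalDegree_finsetProd _ _).trans ?_
      exact Finset.sum_le_card_nsmul _ _ _ fun j _ => hbdeg j
    have h3 : J.card + Jᶜ.card = Nat.card (M.EdgeOf i) := by
      rw [Finset.card_add_card_compl, Nat.card_eq_fintype_card]
    have h4 : 1 ≤ J.card := Finset.card_pos.2 ⟨j₀, hj₀⟩
    have h5 := bubbleMultiplicity_pos (M.cell i)
    rw [gradDegree_eq, ← h3] at hr
    have h6 : J.card + Jᶜ.card * bubbleMultiplicity (M.cell i) ≤
        bubbleMultiplicity (M.cell i) * (J.card + Jᶜ.card) := by nlinarith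
    omega
  set φ : VecPoly r := fun l =>
    ⟨MvPolynomial.C ((M.edge j₀).normal l) * (B * Polynomial.aeval τ p), hdeg l⟩ with hφ
  -- The integrand of the boundary term on each edge as a polynomial in the edge parameter. It is
  -- zero off `J` thanks to `B` and nonnegative on `J` thanks to `p`.
  set P : M.EdgeOf i → Polynomial ℝ := fun j => ((v.2 j).1 - Polynomial.C c) *
    ((M.edge j).restrict B * (M.edge j).restrict (Polynomial.aeval τ p) *
      Polynomial.C (∑ l, (M.edge j₀).normal l * (M.edge j).outwardNormal (M.cell i) l)) with hP
  have hPeval : ∀ (j : M.EdgeOf i) (t : ℝ), (P j).eval t =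
      ((v.2 j).1.eval t - peval ((M.edge j).point t) v.1.1) *
        (φ.val ((M.edge j).point t) ⬝ᵥ fun l => (M.edge j).outwardNormal (M.cell i) l) := by
    intro j t
    simp only [hP, Polynomial.eval_mul, Polynomial.eval_sub, Polynomial.eval_C,
      Edge.eval_restrict, hc, hφ, VecPoly.val, dotProduct, peval_mul, Fin.sum_univ_two]
    simp only [peval, MvPolynomial.eval_C]
    ring
  have hPout : ∀ j ∉ J, P j = 0 := by
    intro j hj
    have h1 : (M.edge j).restrict B = 0 := by
      rw [hB, map_prod]
      refine Finset.prod_eq_zero (Finset.mem_compl.2 hj) (Polynomial.funext fun t => ?_)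
      rw [Edge.eval_restrict, Polynomial.eval_zero]
      exact (hb0 j _).2 (Edge.height_point _ _)
    simp only [hP, h1, zero_mul, mul_zero]
  have hPpos : ∀ j ∈ J, ∀ t ∈ Ioo (0 : ℝ) 1, 0 ≤ (P j).eval t := by
    intro j hj t ht
    have h1 : 0 ≤ peval ((M.edge j).point t) B := by
      rw [hB, peval_prod]
      refine Finset.prod_nonneg fun j' _ => hbpos j' _ (frontier_subset_closure (j.2 ?_))
      rw [Edge.carrier_eq_image]
      exact mem_image_of_mem _ (Ioo_subset_Icc_self ht)
    have h2 : α j + t * (β j - α j) ∈ Ioo (min (α j) (β j)) (max (α j) (β j)) := by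
      rcases lt_or_gt_of_ne (hαβ j hj) with h | h
      · rw [min_eq_left h.le, max_eq_right h.le]
        constructor <;> nlinarith [ht.1, ht.2]
      · rw [min_eq_right h.le, max_eq_left h.le]
        constructor <;> nlinarith [ht.1, ht.2]
    have h3 : (w j).eval (α j + t * (β j - α j)) = ((v.2 j).1 - Polynomial.C c).eval t *
        ∑ l, (M.edge j₀).normal l * (M.edge j).outwardNormal (M.cell i) l := by
      rw [hw]
      by_cases hjj : j = j₀
      · subst hjj
        simp only [if_pos, Polynomial.eval_mul, Polynomial.eval_C]
        rw [← hparam, hτ, Edge.peval_paramPoly_point]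
      · obtain ⟨d, hd⟩ := hconst j hjj ((Edge.carrier_subset_line_iff _ _).2 ((hmemJ j).1 hj))
        simp [hjj, hd]
    have h4 := mul_nonneg h1 (hpos j hj _ h2)
    rw [h3] at h4
    simp only [hP, Polynomial.eval_mul, Edge.eval_restrict, peval_polynomial_aeval, hparam,
      Polynomial.eval_C]
    linarith
  have hsum := M.weakGradRhs_eq_zero hv φ
  rw [weakGradRhs_eq] at hsum
  simp only [← hPeval] at hsum
  simp only [hc, MvPolynomial.pderiv_C] at hsum
  have hzero : ∫ x in M.cell i, ∑ l : Fin 2, peval x 0 * peval x (φ l).1 = 0 := by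
    simp [peval]
  rw [hzero, zero_add] at hsum
  have hnn : ∀ j : M.EdgeOf i, 0 ≤ (M.edge j).integral fun t => (P j).eval t := by
    intro j
    by_cases hj : j ∈ J
    · exact mul_nonneg (M.edge j).length_pos.le (integral_eval_nonneg (hPpos j hj))
    · simp [Edge.integral, hPout j hj]
  have h0 := (Finset.sum_eq_zero_iff_of_nonneg fun j _ => hnn j).1 hsum j₀ (Finset.mem_univ _)
  have hP0 : P j₀ = 0 := eq_zero_of_integral_eval_eq_zero (hPpos j₀ hj₀)
    ((mul_eq_zero.1 h0).resolve_left (M.edge j₀).length_pos.ne')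
  -- The other factors of `P j₀` are nonzero: `B` because an edge whose weight vanishes along `j₀`
  -- would belong to `J`, `p(τ)` because it restricts to `p`, and `n₀·n` because on `j₀` it is the
  -- sign `side`.
  refine sub_eq_zero.1 ((mul_eq_zero.1 hP0).resolve_right
    (mul_ne_zero (mul_ne_zero ?_ ?_) ?_))
  · rw [hB, map_prod]
    refine Finset.prod_ne_zero_iff.2 fun j hj h1 => Finset.mem_compl.1 hj ((hmemJ j).2 ?_)
    rw [← Edge.carrier_subset_line_iff]
    refine Edge.carrier_subset_line_of_common (Edge.height_point _) fun t => ?_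
    rw [← hb0 j, ← Edge.eval_restrict, h1, Polynomial.eval_zero]
  · intro h1
    refine hp0 (Polynomial.funext fun t => ?_)
    have h2 := congrArg (Polynomial.eval t) h1
    rwa [Edge.eval_restrict, peval_polynomial_aeval, hτ, Edge.peval_paramPoly_point] at h2
  · rw [Ne, Polynomial.C_eq_zero, Fin.sum_univ_two, Edge.outwardNormal_apply,
      Edge.outwardNormal_apply]
    intro h1
    have h2 := (M.edge j₀).normal_sq
    refine (M.edge j₀).side_ne_zero (M.cell i) ?_
    linear_combination h1 - (M.edge j₀).side (M.cell i) * h2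

/-- On `V_h⁰` the discrete weak gradient is injective. -/
theorem eq_zero_of_weakGrad_eq_zero [Fintype ι] (hcol : M.CollinearityCondition) (hqk : q ≤ k)
    {r : ι → ℕ} (hr : ∀ i, M.gradDegree k i ≤ r i) {v : M.BrokenSpace k q}
    (hvt : v ∈ M.testSpace k q) (hv : ∀ i, M.weakGrad (r i) i (v i) = 0) : v = 0 := by
  choose c hc using fun i => M.exists_eq_C_of_weakGrad_eq_zero (hr i) (hv i)
  have hconst : ∀ (i : ι) (j : M.EdgeOf i), ∃ d, ((v i).2 j).1 = Polynomial.C d := by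
    by_contra hcon
    -- The interior edges on which some trace of `v_b` is not constant. On boundary edges `v_b` is
    -- zero, so they never enter.
    set S : Set κ := {j | ¬ (M.edge j).carrier ⊆ frontier Ω ∧
      ∃ (i : ι) (h : (M.edge j).carrier ⊆ frontier (M.cell i)),
        ¬ ∃ d, ((v i).2 ⟨j, h⟩).1 = Polynomial.C d} with hS
    have hout : ∀ (i : ι) (j : M.EdgeOf i), j.1 ∉ S → ∃ d, ((v i).2 j).1 = Polynomial.C d := by
      intro i j hj
      by_contra hd
      by_cases hb : (M.edge j).carrier ⊆ frontier Ω
      · exact hd ⟨0, by rw [hvt.2 i j hb]; simp⟩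
      · exact hj ⟨hb, i, j.2, hd⟩
    obtain ⟨j, hjS, i, hi, hline⟩ := hcol S (by
      by_contra hne
      rw [Set.not_nonempty_iff_eq_empty] at hne
      exact hcon fun i j => hout i j (by rw [hne]; exact notMem_empty _)) fun j hj => hj.1
    obtain ⟨-, i', hi', hd⟩ := hjS
    refine hd ⟨c i, ?_⟩
    -- The trace is nonconstant as seen from `i'`, but the collinearity condition speaks of another
    -- element `i`; single-valuedness of `v_b` allows the change.
    rw [← hvt.1 i i' j hi hi']
    refine M.eq_C_of_weakGrad_eq_zero hqk (hr i) (hv i) (hc i) ⟨j, hi⟩ fun j' hne hl => ?_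
    refine hout i j' fun hj'S => hline j' hj'S (fun h => hne (Subtype.ext h)) j'.2 hl
  -- Now that all traces are constant, the hypothesis on collinear edges holds for every edge.
  have hedge : ∀ (i : ι) (j : M.EdgeOf i), ((v i).2 j).1 = Polynomial.C (c i) := fun i j =>
    M.eq_C_of_weakGrad_eq_zero hqk (hr i) (hv i) (hc i) j fun j' _ _ => hconst i j'
  choose i₀ hi₀ using M.edge_used
  have hc0 : ∀ i, c i = 0 := by
    refine M.eq_zero_of_no_jump c (fun j => c (i₀ j)) (fun i j h => ?_) fun j hj => ?_
    · have h1 := hedge i ⟨j, h⟩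
      rw [hvt.1 i (i₀ j) j h (hi₀ j), hedge (i₀ j) ⟨j, hi₀ j⟩] at h1
      exact (Polynomial.C_injective h1).symm
    · have h1 := hedge (i₀ j) ⟨j, hi₀ j⟩
      rw [hvt.2 (i₀ j) ⟨j, hi₀ j⟩ hj] at h1
      exact (Polynomial.C_eq_zero.1 h1.symm)
  funext i
  refine Prod.ext (Subtype.ext ?_) (funext fun j => Subtype.ext ?_)
  · rw [hc i, hc0 i]; simp
  · rw [hedge i j, hc0 i]; simp

end PolygonalMesh

/-! ## The discrete problem -/

theorem IsDiffusionTensor.integrableOn {Ω S : Set Pt} {A : Pt → Matrix (Fin 2) (Fin 2) ℝ}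
    (hA : IsDiffusionTensor Ω A) (hS : IsOpen S) (hb : Bornology.IsBounded S) (hsub : S ⊆ Ω)
    {r : ℕ} (φ ψ : VecPoly r) :
    IntegrableOn (fun x => (A x).mulVec (φ.val x) ⬝ᵥ ψ.val x) S := by
  obtain ⟨C, hC⟩ := hA.bounded
  have h1 : ∀ l m, IntegrableOn (fun x => A x l m * (peval x (φ m).1 * peval x (ψ l).1)) S :=
    fun l m => (integrableOn_of_continuous hb
      ((continuous_peval _).mul (continuous_peval _))).bdd_mul (c := C)
      ((hA.aestronglyMeasurable l m).mono_measure (Measure.restrict_mono_set _ hsub))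
      ((ae_restrict_iff' hS.measurableSet).2 (Eventually.of_forall fun x hx => hC x (hsub hx) l m))
  have h2 : IntegrableOn (fun x => ∑ l, ∑ m, A x l m * (peval x (φ m).1 * peval x (ψ l).1)) S :=
    integrable_finsetSum _ fun l _ => integrable_finsetSum _ fun m _ => h1 l m
  refine h2.congr (Eventually.of_forall fun x => ?_)
  simp only [dotProduct, Matrix.mulVec, VecPoly.val, Finset.sum_mul, mul_assoc]

theorem integrableOn_mul_peval {S Ω : Set Pt} {f : Pt → ℝ} (hf : MemLp f 2 (volume.restrict Ω))
    (hS : IsOpen S) (hb : Bornology.IsBounded S) (hsub : S ⊆ Ω) (p : MvPolynomial (Fin 2) ℝ) :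
    IntegrableOn (fun x => f x * peval x p) S := by
  have : IsFiniteMeasure (volume.restrict S) :=
    isFiniteMeasure_restrict.2 hb.measure_lt_top.ne
  have h1 : IntegrableOn f S :=
    (hf.mono_measure (Measure.restrict_mono_set _ hsub)).integrable (by norm_num)
  obtain ⟨C, hC⟩ := hb.isCompact_closure.exists_bound_of_continuousOn
    (continuous_peval p).continuousOn
  exact h1.mul_bdd (c := C) (continuous_peval p).aestronglyMeasurable
    ((ae_restrict_iff' hS.measurableSet).2
      (Eventually.of_forall fun x hx => hC x (subset_closure hx)))

theorem Edge.SquareIntegrable.intervalIntegrable_mul {e : Edge} {g : Pt → ℝ}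
    (hg : e.SquareIntegrable g) (p : Polynomial ℝ) :
    IntervalIntegrable (fun t => g (e.point t) * p.eval t) volume 0 1 := by
  rw [intervalIntegrable_iff_integrableOn_Icc_of_le zero_le_one]
  have h1 : IntegrableOn (fun t => g (e.point t)) (Icc (0 : ℝ) 1) :=
    MemLp.integrable (by norm_num) hg
  exact h1.mul_continuousOn p.continuous.continuousOn isCompact_Icc

namespace PolygonalMesh

variable {Ω Ω₁ Ω₂ : Set Pt} {ι κ : Type*} (M : PolygonalMesh Ω ι κ) {k q : ℕ}

/-- The essential conditions on a solution: membership in `V_h` and the conditions on `∂Ω ∖ Γ` and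
on `Γ`. -/
structure IsAdmissible (Ω₁ Ω₂ : Set Pt) (g gD : Pt → ℝ) (u : M.BrokenSpace k q) : Prop where
  mem_space : u ∈ M.space k q (interface Ω₁ Ω₂)
  boundary : ∀ (i : ι) (j : M.EdgeOf i), (M.edge j).carrier ⊆ frontier Ω →
    ¬ (M.edge j).carrier ⊆ interface Ω₁ Ω₂ → (u i).2 j = edgeProj q (M.edge j) g
  jump : ∀ (i i' : ι) (j : κ) (h : (M.edge j).carrier ⊆ frontier (M.cell i))
    (h' : (M.edge j).carrier ⊆ frontier (M.cell i')), M.cell i ⊆ Ω₁ → M.cell i' ⊆ Ω₂ →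
      (M.edge j).carrier ⊆ interface Ω₁ Ω₂ →
        (u i).2 ⟨j, h⟩ - (u i').2 ⟨j, h'⟩ = edgeProj q (M.edge j) gD

variable {M}

theorem not_subset_right_of_subset_left (hfit : IsInterfaceFitted M Ω₁ Ω₂) {i : ι}
    (h : M.cell i ⊆ Ω₁) : ¬ M.cell i ⊆ Ω₂ := by
  intro h'
  obtain ⟨x, hx⟩ := (M.polygon i).isConnected.nonempty
  exact Set.disjoint_left.1 hfit.disjoint (h hx) (h' hx)

theorem IsAdmissible.add_mem_testSpace {g gD : Pt → ℝ} {u v : M.BrokenSpace k q}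
    (hu : M.IsAdmissible Ω₁ Ω₂ g gD u) (hv : v ∈ M.testSpace k q) :
    M.IsAdmissible Ω₁ Ω₂ g gD (u + v) := by
  refine ⟨fun i i' j h h' hΓ => ?_, fun i j hj hΓ => ?_, fun i i' j h h' hi hi' hΓ => ?_⟩ <;>
    simp only [Pi.add_apply, Prod.snd_add]
  · rw [hu.mem_space i i' j h h' hΓ, hv.1 i i' j h h']
  · rw [hu.boundary i j hj hΓ, hv.2 i j hj, add_zero]
  · rw [hv.1 i i' j h h', add_sub_add_right_eq_sub, hu.jump i i' j h h' hi hi' hΓ]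

/-- Polynomials on different edges can be prescribed independently, so there is no compatibility
condition: the interior component is zero, the whole jump is put on the `Ω₁` side of `Γ`, and `Q_b
g` is used on boundary edges off `Γ`. -/
theorem exists_isAdmissible (hfit : IsInterfaceFitted M Ω₁ Ω₂) (g gD : Pt → ℝ) :
    ∃ u : M.BrokenSpace k q, M.IsAdmissible Ω₁ Ω₂ g gD u := by
  classical
  refine ⟨fun i => (0, fun j => if (M.edge j).carrier ⊆ interface Ω₁ Ω₂ then
    (if M.cell i ⊆ Ω₁ then edgeProj q (M.edge j) gD else 0) else
    if (M.edge j).carrier ⊆ frontier Ω then edgeProj q (M.edge j) g else 0),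
    fun i i' j h h' hΓ => ?_, fun i j hj hΓ => ?_, fun i i' j h h' hi hi' hΓ => ?_⟩
  · simp only [if_neg hΓ]
  · simp only [if_neg hΓ, if_pos hj]
  · have h1 : ¬ M.cell i' ⊆ Ω₁ := fun h1 => not_subset_right_of_subset_left hfit h1 hi'
    simp only [if_pos hΓ, if_pos hi, if_neg h1, sub_zero]

/-! ### Linearity and definiteness of the discrete forms -/

variable (M) [Fintype κ]

theorem weakGradRhs_add_smul {r : ℕ} (i : ι) (a : ℝ) (v w : M.LocalSpace k q i) (φ : VecPoly r) :
    M.weakGradRhs i (a • v + w) φ = a * M.weakGradRhs i v φ + M.weakGradRhs i w φ := by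
  have hb := (M.polygon i).isBounded
  have h1 : ∫ x in M.cell i, peval x (a • v + w).1 * peval x φ.div =
      a * (∫ x in M.cell i, peval x v.1 * peval x φ.div) +
        ∫ x in M.cell i, peval x w.1 * peval x φ.div := by
    rw [← integral_const_mul, ← integral_add]
    · congr 1; ext x
      simp [peval]; ring
    · exact integrableOn_of_continuous hb
        (continuous_const.mul ((continuous_peval _).mul (continuous_peval _)))
    · exact integrableOn_of_continuous hb ((continuous_peval _).mul (continuous_peval _))
  have h2 : ∀ j : M.EdgeOf i, ((M.edge j).integral fun t => ((a • v + w).2 j).1.eval t *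
      (φ.val ((M.edge j).point t) ⬝ᵥ fun l => (M.edge j).outwardNormal (M.cell i) l)) =
      (a * (M.edge j).integral fun t => (v.2 j).1.eval t *
        (φ.val ((M.edge j).point t) ⬝ᵥ fun l => (M.edge j).outwardNormal (M.cell i) l)) +
      (M.edge j).integral fun t => (w.2 j).1.eval t *
        (φ.val ((M.edge j).point t) ⬝ᵥ fun l => (M.edge j).outwardNormal (M.cell i) l) := by
    intro j
    unfold Edge.integral
    rw [mul_left_comm, ← mul_add, ← intervalIntegral.integral_const_mul a,
      ← intervalIntegral.integral_add]
    · congr 2; ext t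
      simp; ring
    · exact (continuous_const.mul ((v.2 j).1.continuous.mul
        (continuous_dotProduct_val _ _ _))).intervalIntegrable _ _
    · exact ((w.2 j).1.continuous.mul (continuous_dotProduct_val _ _ _)).intervalIntegrable _ _
  unfold weakGradRhs
  rw [h1, Finset.sum_congr rfl fun j _ => h2 j, Finset.sum_add_distrib, ← Finset.mul_sum]
  ring

/-- Linearity follows from uniqueness: the combination of the weak gradients satisfies the defining
identity of the weak gradient of the combination. -/
theorem weakGrad_add_smul {r : ℕ} (i : ι) (a : ℝ) (v w : M.LocalSpace k q i) :
    M.weakGrad r i (a • v + w) = a • M.weakGrad r i v + M.weakGrad r i w := by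
  refine (M.weakGrad_existsUnique r i (a • v + w)).unique (M.weakGrad_spec r i _) fun φ => ?_
  rw [weakGradRhs_add_smul, ← weakGrad_spec, ← weakGrad_spec]
  have hb := (M.polygon i).isBounded
  have h := LinearMap.congr_fun ((vecForm r hb).map_add (a • M.weakGrad r i v) (M.weakGrad r i w)) φ
  rw [map_smul] at h
  exact h

section Forms

variable [Fintype ι] {A : Pt → Matrix (Fin 2) (Fin 2) ℝ} (hA : IsDiffusionTensor Ω A)
  (r : ι → ℕ)

include hA in
theorem energyForm_add_smul_left (a : ℝ) (u v w : M.BrokenSpace k q) :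
    M.energyForm A r (a • u + v) w = a * M.energyForm A r u w + M.energyForm A r v w := by
  have hint := fun i (φ ψ : VecPoly (r i)) => hA.integrableOn (M.polygon i).isOpen
    (M.polygon i).isBounded (M.cell_subset i) φ ψ
  unfold energyForm
  rw [Finset.mul_sum, ← Finset.sum_add_distrib]
  refine Finset.sum_congr rfl fun i _ => ?_
  rw [← integral_const_mul, ← integral_add ((hint i _ _).const_mul a) (hint i _ _)]
  congr 1; ext x
  rw [Pi.add_apply, Pi.smul_apply, weakGrad_add_smul]
  simp [VecPoly.val, dotProduct, Matrix.mulVec, peval, Fin.sum_univ_two]; ring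

include hA in
theorem energyForm_add_smul_right (a : ℝ) (u v w : M.BrokenSpace k q) :
    M.energyForm A r w (a • u + v) = a * M.energyForm A r w u + M.energyForm A r w v := by
  have hint := fun i (φ ψ : VecPoly (r i)) => hA.integrableOn (M.polygon i).isOpen
    (M.polygon i).isBounded (M.cell_subset i) φ ψ
  unfold energyForm
  rw [Finset.mul_sum, ← Finset.sum_add_distrib]
  refine Finset.sum_congr rfl fun i _ => ?_
  rw [← integral_const_mul, ← integral_add ((hint i _ _).const_mul a) (hint i _ _)]
  congr 1; ext x
  rw [Pi.add_apply, Pi.smul_apply, weakGrad_add_smul]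
  simp [VecPoly.val, dotProduct, Matrix.mulVec, peval, Fin.sum_univ_two]; ring

-- On each element the energy is at least `c` times the squared `L²` norm of the weak gradient, so a
-- zero sum forces every one of these norms to vanish.
include hA in
theorem weakGrad_eq_zero_of_energyForm_eq_zero {v : M.BrokenSpace k q}
    (h : M.energyForm A r v v = 0) (i : ι) : M.weakGrad (r i) i (v i) = 0 := by
  obtain ⟨c, hc, hpos⟩ := hA.posDef
  have hint := fun i (φ ψ : VecPoly (r i)) => hA.integrableOn (M.polygon i).isOpen
    (M.polygon i).isBounded (M.cell_subset i) φ ψ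
  have hself : ∀ (n : ℕ) (φ : VecPoly n), Continuous fun x => φ.val x ⬝ᵥ φ.val x := by
    intro n φ
    simp only [VecPoly.val, dotProduct]
    exact continuous_finsetSum _ fun l _ => (continuous_peval _).mul (continuous_peval _)
  have hlow : ∀ i, c * ∫ x in M.cell i,
      (M.weakGrad (r i) i (v i)).val x ⬝ᵥ (M.weakGrad (r i) i (v i)).val x ≤
      ∫ x in M.cell i, (A x).mulVec ((M.weakGrad (r i) i (v i)).val x) ⬝ᵥ
        (M.weakGrad (r i) i (v i)).val x := by
    intro i
    rw [← integral_const_mul]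
    refine setIntegral_mono_on ((integrableOn_of_continuous (M.polygon i).isBounded
      (hself _ _)).const_mul c) (hint i _ _) (M.polygon i).isOpen.measurableSet fun x hx => ?_
    rw [dotProduct_comm (Matrix.mulVec _ _)]
    exact hpos x (M.cell_subset i hx) _
  have hnn : ∀ i, 0 ≤ ∫ x in M.cell i,
      (M.weakGrad (r i) i (v i)).val x ⬝ᵥ (M.weakGrad (r i) i (v i)).val x := fun i =>
    integral_nonneg fun x => by
      simpa using Finset.sum_nonneg fun l (_ : l ∈ Finset.univ) => mul_self_nonneg
        ((M.weakGrad (r i) i (v i)).val x l)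
  have h0 := (Finset.sum_eq_zero_iff_of_nonneg fun i _ =>
    (mul_nonneg hc.le (hnn i)).trans (hlow i)).1 h i (Finset.mem_univ i)
  refine vecForm_definite (r i) (M.polygon i).isBounded (M.polygon i).isOpen
    (M.polygon i).isConnected.nonempty _ (le_antisymm ?_ (hnn i))
  have h1 := hlow i
  rw [h0] at h1
  exact nonpos_of_mul_nonpos_right h1 hc

theorem load_add_smul {f gN : Pt → ℝ} (hf : MemLp f 2 (volume.restrict Ω))
    (hgN : ∀ j, (M.edge j).carrier ⊆ interface Ω₁ Ω₂ → (M.edge j).SquareIntegrable gN)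
    (a : ℝ) (v w : M.BrokenSpace k q) :
    M.load Ω₁ Ω₂ f gN (a • v + w) = a * M.load Ω₁ Ω₂ f gN v + M.load Ω₁ Ω₂ f gN w := by
  classical
  have hint := fun i p => integrableOn_mul_peval hf (M.polygon i).isOpen (M.polygon i).isBounded
    (M.cell_subset i) p
  have h1 : ∑ i, (∫ x in M.cell i, f x * peval x ((a • v + w) i).1) =
      a * ∑ i, (∫ x in M.cell i, f x * peval x (v i).1) +
        ∑ i, ∫ x in M.cell i, f x * peval x (w i).1 := by
    rw [Finset.mul_sum, ← Finset.sum_add_distrib]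
    refine Finset.sum_congr rfl fun i _ => ?_
    rw [← integral_const_mul, ← integral_add ((hint i _).const_mul a) (hint i _)]
    congr 1; ext x
    simp [peval]; ring
  unfold load
  rw [h1, mul_add, add_add_add_comm]
  rw [add_right_inj]
  rw [Finset.mul_sum, ← Finset.sum_add_distrib]
  refine Finset.sum_congr rfl fun i _ => ?_
  rw [Finset.mul_sum, ← Finset.sum_add_distrib]
  refine Finset.sum_congr rfl fun j _ => ?_
  split_ifs with h
  · have hg := hgN j h.2
    unfold Edge.integral
    rw [mul_left_comm, ← mul_add, ← intervalIntegral.integral_const_mul a,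
      ← intervalIntegral.integral_add ((hg.intervalIntegrable_mul _).const_mul a)
        (hg.intervalIntegrable_mul _)]
    congr 2; ext t
    simp; ring
  · simp

end Forms

variable {M}

/-- The jump condition compares only elements in different subdomains, and the boundary condition is
imposed only off `Γ`. This loses nothing, since two elements of the same subdomain at an edge in `Γ`
coincide and no edge in `∂Ω` lies in `Γ`. -/
theorem IsAdmissible.sub_mem_testSpace (hfit : IsInterfaceFitted M Ω₁ Ω₂) {g gD : Pt → ℝ}
    {u u' : M.BrokenSpace k q} (hu : M.IsAdmissible Ω₁ Ω₂ g gD u)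
    (hu' : M.IsAdmissible Ω₁ Ω₂ g gD u') : u - u' ∈ M.testSpace k q := by
  refine ⟨fun i i' j h h' => ?_, fun i j hj => ?_⟩
  · simp only [Pi.sub_apply, Prod.snd_sub]
    by_cases hΓ : (M.edge j).carrier ⊆ interface Ω₁ Ω₂
    · rcases hfit.fitted i with hi | hi <;> rcases hfit.fitted i' with hi' | hi'
      · obtain rfl := eq_of_subset_interface hfit hΓ h h' hi hi'
        rfl
      · rw [sub_eq_sub_iff_sub_eq_sub, hu.jump i i' j h h' hi hi' hΓ,
          hu'.jump i i' j h h' hi hi' hΓ]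
      · refine Eq.symm ?_
        rw [sub_eq_sub_iff_sub_eq_sub, hu.jump i' i j h' h hi' hi hΓ,
          hu'.jump i' i j h' h hi' hi hΓ]
      · obtain rfl := eq_of_subset_interface (isInterfaceFitted_swap hfit)
          (by rwa [interface, inter_comm]) h h' hi hi'
        rfl
    · rw [hu.mem_space i i' j h h' hΓ, hu'.mem_space i i' j h h' hΓ]
  · have hΓ := not_subset_interface_of_subset_frontier hfit hj
    simp only [Pi.sub_apply, Prod.snd_sub]
    rw [hu.boundary i j hj hΓ, hu'.boundary i j hj hΓ, sub_self]

end PolygonalMesh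

end WG

end

/-! ### Reduction to the homogeneous space -/

theorem mainTheorem2 {Ω Ω₁ Ω₂ : Set WG.Pt} {ι κ : Type*} [Fintype ι] [Fintype κ]
    (M : WG.PolygonalMesh Ω ι κ) (hfit : WG.IsInterfaceFitted M Ω₁ Ω₂)
    (hcol : M.CollinearityCondition)
    (A : WG.Pt → Matrix (Fin 2) (Fin 2) ℝ) (hA : WG.IsDiffusionTensor Ω A)
    (k q : ℕ) (hqk : q ≤ k) (r : ι → ℕ) (hr : ∀ i, M.gradDegree k i ≤ r i)
    (f g gD gN : WG.Pt → ℝ) (hf : MeasureTheory.MemLp f 2 (MeasureTheory.volume.restrict Ω))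
    (hg : ∀ j, (M.edge j).carrier ⊆ frontier Ω →
      ¬ (M.edge j).carrier ⊆ WG.interface Ω₁ Ω₂ → (M.edge j).SquareIntegrable g)
    (hgD : ∀ j, (M.edge j).carrier ⊆ WG.interface Ω₁ Ω₂ → (M.edge j).SquareIntegrable gD)
    (hgN : ∀ j, (M.edge j).carrier ⊆ WG.interface Ω₁ Ω₂ → (M.edge j).SquareIntegrable gN) :
    ∃! u : M.BrokenSpace k q, M.IsWGSolution Ω₁ Ω₂ A f g gD gN r u := by
  obtain ⟨u₀, hu₀⟩ := WG.PolygonalMesh.exists_isAdmissible (k := k) (q := q) hfit g gD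
  have hleft := fun a u v w => M.energyForm_add_smul_left (k := k) (q := q) hA r a u v w
  have hright := fun a u v w => M.energyForm_add_smul_right (k := k) (q := q) hA r a u v w
  have hload := fun a v w => M.load_add_smul (k := k) (q := q) hf hgN a v w
  have hleft0 : ∀ w : M.BrokenSpace k q, M.energyForm A r 0 w = 0 := fun w => by
    have := hleft 1 0 0 w; simp at this; exact this
  have hright0 : ∀ w : M.BrokenSpace k q, M.energyForm A r w 0 = 0 := fun w => by
    have := hright 1 0 0 w; simp at this; exact this
  have hload0 : M.load Ω₁ Ω₂ f gN (0 : M.BrokenSpace k q) = 0 := by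
    have := hload 1 0 0; simp at this; exact this
  let B : M.testSpace k q →ₗ[ℝ] M.testSpace k q →ₗ[ℝ] ℝ :=
    LinearMap.mk₂ ℝ (fun v w => M.energyForm A r v.1 w.1)
      (fun u v w => by simpa using hleft 1 u.1 v.1 w.1)
      (fun a v w => by simpa [hleft0] using hleft a v.1 0 w.1)
      (fun w u v => by simpa using hright 1 u.1 v.1 w.1)
      (fun a w v => by simpa [hright0] using hright a v.1 0 w.1)
  -- The residual of the lift `u₀`; representing it by the energy form gives the correction to `u₀`
  -- in `V_h⁰`.
  let L : M.testSpace k q →ₗ[ℝ] ℝ :=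
    { toFun := fun w => M.load Ω₁ Ω₂ f gN w.1 - M.energyForm A r u₀ w.1
      map_add' := fun v w => by
        have h1 := hload 1 v.1 w.1
        have h2 := hright 1 v.1 w.1 u₀
        simp only [one_smul, one_mul] at h1 h2
        rw [Submodule.coe_add, h1, h2]; ring
      map_smul' := fun a v => by
        have h1 := hload a v.1 0
        have h2 := hright a v.1 0 u₀
        simp only [add_zero, hload0, hright0] at h1 h2
        rw [Submodule.coe_smul, h1, h2]; simp; ring }
  have hB : ∀ v, B v v = 0 → v = 0 := fun v hv => Subtype.ext
    (M.eq_zero_of_weakGrad_eq_zero hcol hqk hr v.2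
      (M.weakGrad_eq_zero_of_energyForm_eq_zero hA r hv))
  obtain ⟨v, hv, huniq⟩ := WG.existsUnique_repr (V := M.testSpace k q) B hB L
  have hsplit : ∀ x w : M.BrokenSpace k q,
      M.energyForm A r (u₀ + x) w = M.energyForm A r u₀ w + M.energyForm A r x w := fun x w => by
    simpa using hleft 1 u₀ x w
  have hadm := hu₀.add_mem_testSpace v.2
  refine ⟨u₀ + v.1, ⟨hadm.mem_space, hadm.boundary, hadm.jump, fun w hw => ?_⟩, fun u hu => ?_⟩
  · have h1 : M.energyForm A r v.1 w = M.load Ω₁ Ω₂ f gN w - M.energyForm A r u₀ w :=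
      hv ⟨w, hw⟩
    rw [hsplit, h1]; ring
  · have hmem := WG.PolygonalMesh.IsAdmissible.sub_mem_testSpace hfit
      ⟨hu.mem_space, hu.boundary, hu.jump⟩ hu₀
    -- Any other solution differs from `u₀` by an element of `V_h⁰` that represents the same
    -- residual.
    have h1 := huniq ⟨u - u₀, hmem⟩ fun w => by
      change M.energyForm A r (u - u₀) w.1 = M.load Ω₁ Ω₂ f gN w.1 - M.energyForm A r u₀ w.1
      have h2 := hsplit (u - u₀) w.1
      rw [add_sub_cancel, hu.equation w.1 w.2] at h2
      linarith
    have h2 : u - u₀ = v.1 := congrArg Subtype.val h1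
    rw [← h2, add_sub_cancel]
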